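/- Let $k$ be an algebraically closed field of characteristic zero and let $\gamma\ge 2$. Let $B$ be the smooth projective model of an odd hyperelliptic curve $y^2=f(x)$ over $k$, where $f\in k[x]$ is separable of degree $2\gamma+1$ and $f(0)\neq 0$; let $q$ be its unique point over $x=\infty$, fix a square root $\sqrt{f(0)}$ of $f(0)$, and put $p=(0,\sqrt{f(0)})\in B$. Let $\sum_{i\ge 0}a_ix^i\in k[[x]]$ be the power series expansion of $y$ at $p$ (where $x$ is a local parameter). For $d\ge 0$ let $\Theta_d\subset\mathrm{Jac}(B)$ be the set of divisor classes of the form $[p_1+\dots+p_d-dq]$ with $p_1,\dots,p_d\in B$, let $\Theta_{-1}=\emptyset$, and let $\Theta_d^0=\Theta_d\setminus\Theta_{d-1}$. The multiplication profile of $[p-q]$ is the sequence $(\varepsilon_j)_{j\ge1}$ in which $\varepsilon_j$ is the unique integer such that $j[p-q]\in\Theta^0_{\varepsilon_j}$. For $n\ge\gamma+2$ put $$D_n=\begin{cases}\det\bigl(a_{\gamma+2+i+j}\bigr)_{0\le i,j<(n-\gamma-1)/2} & \text{if } n+\gamma \text{ is odd},\\[4pt] \det\bigl(a_{\gamma+1+i+j}\bigr)_{0\le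 i,j<(n-\gamma)/2} & \text{if } n+\gamma\text{ is even,}\end{cases}$$ a Hankel determinant in the entries $a_{\gamma+2},\dots,a_{n-1}$, respectively $a_{\gamma+1},\dots,a_{n-1}$. Then: 1. For every $n\ge\gamma+2$, we have $\varepsilon_n<\gamma$ if and only if $D_n=0$. 2. Consequently, the multiplication profile is determined by the vanishing pattern of the $D_n$: if two such data $(f,\sqrt{f(0)})$ and $(f',\sqrt{f'(0)})$ over $k$, with the same $\gamma$, have determinants $D_n$ and $D_n'$ such that $D_n=0\Leftrightarrow D_n'=0$ for every $n\ge\gamma+2$, then $\varepsilon_j=\varepsilon_j'$ for every $j\ge1$. -/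

import Mathlib

open Polynomial
open scoped WithZero

/-- An affine equation `y² = f(x)` of an odd hyperelliptic curve of genus `γ` over `k`:
`f` is separable (squarefree, over a perfect field) of degree `2γ + 1`.
The curve itself is the smooth projective model of this equation. -/
structure OddHyperellipticCurve (k : Type*) [Field k] (γ : ℕ) where
  /-- the right-hand side of the equation `y² = f(x)` -/
  f : k[X]
  natDegree_f : f.natDegree = 2 * γ + 1
  squarefree_f : Squarefree f

namespace OddHyperellipticCurve

variable {k : Type*} [Field k] {γ : ℕ} (C : OddHyperellipticCurve k γ)

/-- The polynomial `T² - f(x)` over the rational function field `k(x)`. -/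
noncomputable def poly : (RatFunc k)[X] :=
  X ^ 2 - Polynomial.C (algebraMap k[X] (RatFunc k) C.f)

theorem irreducible_poly : Irreducible C.poly := by
  refine X_pow_sub_C_irreducible_of_prime Nat.prime_two fun r hr => ?_
  have hf : C.f ≠ 0 := by
    intro h
    have := C.natDegree_f
    simp [h] at this
  have hr0 : r ≠ 0 := by
    rintro rfl
    apply hf
    have : algebraMap k[X] (RatFunc k) C.f = 0 := by rw [← hr]; simp
    simpa using this
  have h := congrArg RatFunc.intDegree hr
  rw [pow_two, RatFunc.intDegree_mul hr0 hr0, RatFunc.intDegree_polynomial, C.natDegree_f] at h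
  push_cast at h
  omega

instance : Fact (Irreducible C.poly) := ⟨C.irreducible_poly⟩

/-- The function field `k(x)[T] / (T² - f(x))` of the curve. -/
abbrev FunctionField : Type _ := AdjoinRoot C.poly

/-- The coordinate function `x`. -/
noncomputable def x : C.FunctionField := AdjoinRoot.of C.poly RatFunc.X

/-- The coordinate function `y`. -/
noncomputable def y : C.FunctionField := AdjoinRoot.root C.poly

theorem y_sq : C.y ^ 2 = aeval C.x C.f := by
  have h : eval₂ (AdjoinRoot.of C.poly) (AdjoinRoot.root C.poly)
      (X ^ 2 - Polynomial.C (algebraMap k[X] (RatFunc k) C.f)) = 0 := AdjoinRoot.eval₂_root C.poly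
  have hx : aeval C.x C.f = AdjoinRoot.of C.poly (algebraMap k[X] (RatFunc k) C.f) := by
    have h1 : aeval C.x C.f = AdjoinRoot.of C.poly (aeval RatFunc.X C.f) := by
      rw [x, aeval_def, aeval_def, hom_eval₂]
      rfl
    rw [h1, RatFunc.aeval_X_left_eq_algebraMap]
  rw [hx, y, ← sub_eq_zero, ← h]
  rw [eval₂_sub, eval₂_pow, eval₂_X, eval₂_C]

/-- The (closed) points of the smooth projective curve: the normalized discrete valuations of the
function field that are trivial on the field of constants `k`. The valuation is written
multiplicatively: `P.val g = exp (-ord_P g)`. -/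
structure Point where
  val : Valuation C.FunctionField ℤᵐ⁰
  surjective : Function.Surjective val
  trivial_on_constants : ∀ c : k, c ≠ 0 → val (algebraMap k C.FunctionField c) = 1

variable {C}

/-- The order of vanishing at `P` of a nonzero rational function (with the value `0` at `0`). -/
noncomputable def Point.ord (P : C.Point) (g : C.FunctionField) : ℤ := -WithZero.log (P.val g)

/-- `P` is the affine point `(a, b)`: the functions `x - a` and `y - b` vanish at `P`. -/
def Point.IsAffine (P : C.Point) (a b : k) : Prop :=
  P.val (C.x - algebraMap k C.FunctionField a) < 1 ∧
    P.val (C.y - algebraMap k C.FunctionField b) < 1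

/-- `P` is the point over `x = ∞`: the function `x` has a pole at `P`. -/
def Point.IsInfinity (P : C.Point) : Prop := 1 < P.val C.x

variable (C)

/-- The degree of a divisor (all points have residue field `k`
when `k` is algebraically closed, so the degree is the sum of the coefficients). -/
noncomputable def degree : (C.Point →₀ ℤ) →+ ℤ := Finsupp.liftAddHom fun _ => AddMonoidHom.id ℤ

/-- The group of divisors of degree zero. -/
abbrev DivZero : Type _ := C.degree.ker

/-- The subgroup of principal divisors `div g`, `g ≠ 0`. -/
noncomputable def principal : AddSubgroup C.DivZero where
  carrier := {D | ∃ g : C.FunctionField, g ≠ 0 ∧ ∀ P : C.Point, D.1 P = P.ord g}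
  zero_mem' := ⟨1, one_ne_zero, fun P => by simp [Point.ord]⟩
  add_mem' := by
    rintro D E ⟨g, hg, hD⟩ ⟨h, hh, hE⟩
    refine ⟨g * h, mul_ne_zero hg hh, fun P => ?_⟩
    have h1 : P.val g ≠ 0 := (Valuation.ne_zero_iff _).2 hg
    have h2 : P.val h ≠ 0 := (Valuation.ne_zero_iff _).2 hh
    simp [Point.ord, hD, hE, WithZero.log_mul h1 h2]
    ring
  neg_mem' := by
    rintro D ⟨g, hg, hD⟩
    refine ⟨g⁻¹, inv_ne_zero hg, fun P => ?_⟩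
    simp [Point.ord, hD, WithZero.log_inv]

/-- The group of points of the Jacobian: degree-zero divisors modulo linear equivalence. -/
abbrev Jac : Type _ := C.DivZero ⧸ C.principal

variable {C}

/-- The class `[p - q]`. -/
noncomputable def pointClass (p q : C.Point) : C.Jac :=
  QuotientAddGroup.mk
    ⟨Finsupp.single p 1 - Finsupp.single q 1, by
      rw [AddMonoidHom.mem_ker, map_sub]; simp [degree]⟩

/-- `Θ_d`, the image of the `d`-th Abel–Jacobi map
`B^d → Jac(B)`, `(p_i) ↦ [∑ p_i - d q]`. -/
def theta (q : C.Point) (d : ℕ) : Set C.Jac :=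
  Set.range fun P : Fin d → C.Point => ∑ i, pointClass (P i) q

/-- `Θ⁰_d = Θ_d \ Θ_{d-1}`, where `Θ_{-1} = ∅`. -/
def thetaZero (q : C.Point) : ℕ → Set C.Jac
  | 0 => theta q 0
  | d + 1 => theta q (d + 1) \ theta q d

/-- The multiplication profile of `z` with respect to `q`: its `j`-th entry (`j ≥ 1`) is the
unique `d` with `j z ∈ Θ⁰_d`. -/
noncomputable def profile (q : C.Point) (z : C.Jac) (j : ℕ) : ℕ :=
  sInf {d | j • z ∈ thetaZero q d}

theorem pointClass_self (q : C.Point) : pointClass q q = 0 := by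
  rw [pointClass, QuotientAddGroup.eq_zero_iff]
  convert zero_mem C.principal
  exact sub_self _

theorem theta_mono (q : C.Point) : Monotone (theta q) := by
  refine monotone_nat_of_le_succ fun d => ?_
  rintro _ ⟨P, rfl⟩
  exact ⟨Fin.snoc P q, by simp [Fin.sum_univ_castSucc, pointClass_self]⟩

/-- The defining integer of a profile entry is unique. -/
theorem thetaZero_unique {q : C.Point} {z : C.Jac} {d e : ℕ}
    (hd : z ∈ thetaZero q d) (he : z ∈ thetaZero q e) : d = e := by
  have key : ∀ {d e : ℕ}, z ∈ thetaZero q d → z ∈ thetaZero q e → ¬ d < e := by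
    intro d e hd he hlt
    obtain ⟨e, rfl⟩ : ∃ m, e = m + 1 := ⟨e - 1, by omega⟩
    refine he.2 (theta_mono q (Nat.lt_succ_iff.1 hlt) ?_)
    cases d with
    | zero => exact hd
    | succ d => exact hd.1
  exact le_antisymm (not_lt.1 (key he hd)) (not_lt.1 (key hd he))

/-- The profile of a point class is well defined. -/
theorem nsmul_mem_thetaZero_profile (p q : C.Point) (j : ℕ) :
    j • pointClass p q ∈ thetaZero q (profile q (pointClass p q) j) := by
  classical
  have hex : ∃ d, j • pointClass p q ∈ theta q d := ⟨j, fun _ => p, by simp⟩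
  refine Nat.sInf_mem (s := {d | j • pointClass p q ∈ thetaZero q d}) ⟨Nat.find hex, ?_⟩
  have h1 := Nat.find_spec hex
  have h2 := fun m => Nat.find_min hex (m := m)
  revert h1 h2
  generalize Nat.find hex = d
  intro h1 h2
  cases d with
  | zero => exact h1
  | succ d => exact ⟨h1, h2 d d.lt_succ_self⟩

/-- `∑ a_i x^i` is the power series expansion of the function `y` at `p`, i.e. the image of `y` in
`k⟦x⟧` (where `x` is a local parameter at `p`): for every `m`, the function
`y - ∑_{i < m} a_i x^i` vanishes at `p` to order at least `m`. -/
def IsExpansionOfY (p : C.Point) (a : PowerSeries k) : Prop :=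
  ∀ m : ℕ, p.val (C.y - aeval C.x (PowerSeries.trunc m a)) ≤ WithZero.exp (-(m : ℤ))

end OddHyperellipticCurve

/-- The determinant `D_n`: the Hankel determinant with entries `a_{γ+2}, …, a_{n-1}` (of size
`(n-γ-1)/2`) if `n + γ` is odd, and with entries `a_{γ+1}, …, a_{n-1}` (of size `(n-γ)/2`) if
`n + γ` is even. It is used for `n ≥ γ + 2`. -/
noncomputable def hankelDet {k : Type*} [Field k] (γ : ℕ) (a : PowerSeries k) (n : ℕ) : k :=
  if Odd (n + γ) then
    (Matrix.of fun i j : Fin ((n - γ - 1) / 2) =>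
      PowerSeries.coeff (γ + 2 + (i : ℕ) + (j : ℕ)) a).det
  else
    (Matrix.of fun i j : Fin ((n - γ) / 2) =>
      PowerSeries.coeff (γ + 1 + (i : ℕ) + (j : ℕ)) a).det

/-- A point `p = (0, b)` of `y² = f(x)` with `b ≠ 0` (so that `b` is a fixed square root of
`f(0) ≠ 0`), the point `q` at infinity, and the power series expansion of `y` at `p`. -/
structure OddHyperellipticCurve.PointData {k : Type*} [Field k] {γ : ℕ}
    (C : OddHyperellipticCurve k γ) where
  b : k
  p : C.Point
  q : C.Point
  a : PowerSeries k
  f_zero_ne_zero : C.f.eval 0 ≠ 0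
  b_sq : b ^ 2 = C.f.eval 0
  isAffine_p : p.IsAffine 0 b
  isInfinity_q : q.IsInfinity
  isExpansion_a : OddHyperellipticCurve.IsExpansionOfY p a

/-! Using `-[P - q] = [ιP - q]` for the hyperelliptic involution `ι`, the class `n[p - q]` lies in
`Θ_d` exactly when some function has divisor `n p + E - (n + d) q` with `E` effective of degree `d`.
Such a function is regular away from `q`, hence of the form `A + B y` with polynomials `A`, `B` in
`x`. At `q` the two summands have pole orders `2 deg A` and `2 deg B + 2γ + 1`, which cannot cancel
by parity. At `p` the order is that of the power series `A + a B`. So `ε_n ≤ d` becomes the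
Padé-type condition `HasInterpolant` (`PointData.profile_le_iff`).

For `d = γ - 1` the polynomial `A` can be eliminated: `B` has `s` free coefficients and must kill
`s` consecutive coefficients of `a B`, a square Hankel system with determinant `D_n`. This is the
first claim (`hasInterpolant_iff_hankelDet`).

For the second claim, the set of `n` with `ε_n < γ` determines the whole profile. Entries are at
most `γ`, neighbours differ by at most one, neighbours below `γ` are never equal, and there is no
local maximum below `γ`. Each maximal run of entries below `γ` is thus a V-shaped valley, so `ε_n ≤
γ - 1 - i` if and only if `ε_m < γ` whenever `|m - n| ≤ i` (`hasInterpolant_iff_window`). Entries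
with `n ≤ γ + 1` do not depend on the curve. -/

section Interpolant

/-! ### Interpolating pairs of polynomials and the shape of the profile. -/

variable {k : Type*} [Field k]

/-- There is a nonzero pair of polynomials `(A, B)` such that `A + B y` has pole order at most
`n + d` at infinity (on a curve `y² = f(x)` with `deg f = 2γ + 1`) and such that `A + a B` is
divisible by `X ^ n`. -/
def HasInterpolant (γ : ℕ) (a : PowerSeries k) (n d : ℕ) : Prop :=
  ∃ A B : k[X], (A ≠ 0 ∨ B ≠ 0) ∧ 2 * A.natDegree ≤ n + d ∧
    (B ≠ 0 → 2 * B.natDegree + 2 * γ + 1 ≤ n + d) ∧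
    (PowerSeries.X : PowerSeries k) ^ n ∣ (A : PowerSeries k) + a * (B : PowerSeries k)

variable {γ : ℕ} {a : PowerSeries k} {n d : ℕ}

theorem PowerSeries.X_pow_dvd_coe_iff {A : k[X]} :
    (PowerSeries.X : PowerSeries k) ^ n ∣ (A : PowerSeries k) ↔ (Polynomial.X : k[X]) ^ n ∣ A := by
  rw [PowerSeries.X_pow_dvd_iff, Polynomial.X_pow_dvd_iff]
  simp

theorem PowerSeries.X_pow_dvd_sub_trunc (a : PowerSeries k) (n : ℕ) :
    (PowerSeries.X : PowerSeries k) ^ n ∣ a - (PowerSeries.trunc n a : PowerSeries k) := by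
  rw [PowerSeries.X_pow_dvd_iff]
  intro m hm
  rw [map_sub, Polynomial.coeff_coe, PowerSeries.coeff_trunc, if_pos hm, sub_self]

theorem HasInterpolant.mono {e : ℕ} (hde : d ≤ e) (h : HasInterpolant γ a n d) :
    HasInterpolant γ a n e := by
  obtain ⟨A, B, h0, hA, hB, hd⟩ := h
  exact ⟨A, B, h0, by omega, fun h => by have := hB h; omega, hd⟩

theorem HasInterpolant.pred (h : HasInterpolant γ a (n + 1) d) : HasInterpolant γ a n (d + 1) := by
  obtain ⟨A, B, h0, hA, hB, hd⟩ := h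
  exact ⟨A, B, h0, by omega, fun h => by have := hB h; omega, (pow_dvd_pow _ n.le_succ).trans hd⟩

/-- Multiplication by `x` adds one zero at `p` and two poles at `q`. -/
theorem HasInterpolant.succ (h : HasInterpolant γ a n d) :
    HasInterpolant γ a (n + 1) (d + 1) := by
  obtain ⟨A, B, h0, hA, hB, hd⟩ := h
  refine ⟨X * A, X * B, by simpa using h0, ?_, fun h => ?_, ?_⟩
  · have := natDegree_mul_le (p := (X : k[X])) (q := A)
    simp only [natDegree_X] at this
    omega
  · have hB0 : B ≠ 0 := right_ne_zero_of_mul h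
    have := natDegree_mul_le (p := (X : k[X])) (q := B)
    simp only [natDegree_X] at this
    have := hB hB0
    omega
  · have : ((X * A : k[X]) : PowerSeries k) + a * ((X * B : k[X]) : PowerSeries k)
        = PowerSeries.X * ((A : PowerSeries k) + a * (B : PowerSeries k)) := by
      push_cast; ring
    rw [this, pow_succ']
    exact mul_dvd_mul_left _ hd

/-- Two pairs of sufficiently small degree are proportional. -/
theorem interpolants_proportional {A B A' B' : k[X]} {N N' : ℕ}
    (hA : 2 * A.natDegree ≤ N) (hB : B ≠ 0 → 2 * B.natDegree + 2 * γ + 1 ≤ N)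
    (hA' : 2 * A'.natDegree ≤ N') (hB' : B' ≠ 0 → 2 * B'.natDegree + 2 * γ + 1 ≤ N')
    (hd : (PowerSeries.X : PowerSeries k) ^ n ∣ (A : PowerSeries k) + a * (B : PowerSeries k))
    (hd' : (PowerSeries.X : PowerSeries k) ^ n ∣ (A' : PowerSeries k) + a * (B' : PowerSeries k))
    (hN : N + N' < 2 * n + 2 * γ + 1) : A * B' = A' * B := by
  -- Eliminating `a` shows that `X ^ n` divides the cross difference, whose degree is below `n` by
  -- `hN`; so it vanishes.
  have key : (PowerSeries.X : PowerSeries k) ^ n ∣ ((A * B' - A' * B : k[X]) : PowerSeries k) := by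
    have h := dvd_sub (hd.mul_left (B' : PowerSeries k)) (hd'.mul_left (B : PowerSeries k))
    convert h using 1
    push_cast
    ring
  rw [PowerSeries.X_pow_dvd_coe_iff] at key
  by_contra hne
  have h1 := natDegree_le_of_dvd key (sub_ne_zero.2 hne)
  rw [natDegree_X_pow] at h1
  have h2 := natDegree_sub_le (A * B') (A' * B)
  have h3 := natDegree_mul_le (p := A) (q := B')
  have h4 := natDegree_mul_le (p := A') (q := B)
  have hn : n ≤ (A * B').natDegree ∨ n ≤ (A' * B).natDegree := le_max_iff.1 (h1.trans h2)
  by_cases hB0 : B = 0 <;> by_cases hB0' : B' = 0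
  · simp [hB0, hB0'] at hne
  · have := hB' hB0'
    simp only [hB0, mul_zero, natDegree_zero] at *
    omega
  · have := hB hB0
    simp only [hB0', mul_zero, natDegree_zero] at *
    omega
  · have := hB hB0
    have := hB' hB0'
    omega

/-- Consecutive profile entries below `γ` are different. -/
theorem HasInterpolant.or_of_consecutive (hd : d + 1 < γ) (h : HasInterpolant γ a n (d + 1))
    (h' : HasInterpolant γ a (n + 1) (d + 1)) :
    HasInterpolant γ a n d ∨ HasInterpolant γ a (n + 1) d := by
  by_contra! hcon
  obtain ⟨A, B, h0, hA, hB, hv⟩ := h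
  obtain ⟨A', B', h0', hA', hB', hv'⟩ := h'
  have hpro := interpolants_proportional hA hB hA' hB' hv ((pow_dvd_pow _ n.le_succ).trans hv')
    (by omega)
  -- If neither pair works for `d`, the pole orders are exactly `n + d + 1` and `n + d + 2`. These
  -- have opposite parity, whereas functions proportional over `k(x)` have pole orders of equal
  -- parity.
  have e1 : 2 * A.natDegree = n + d + 1 ∨ (B ≠ 0 ∧ 2 * B.natDegree + 2 * γ + 1 = n + d + 1) := by
    by_contra! hc
    refine hcon.1 ⟨A, B, h0, by omega, fun hb => ?_, hv⟩
    have := hB hb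
    have := hc.2 hb
    omega
  have e2 : 2 * A'.natDegree = n + d + 2 ∨
      (B' ≠ 0 ∧ 2 * B'.natDegree + 2 * γ + 1 = n + d + 2) := by
    by_contra! hc
    refine hcon.2 ⟨A', B', h0', by omega, fun hb => ?_, hv'⟩
    have := hB' hb
    have := hc.2 hb
    omega
  rcases e1 with e1 | ⟨hb, e1⟩ <;> rcases e2 with e2 | ⟨hb', e2⟩
  · omega
  · have hA0 : A ≠ 0 := by rintro rfl; simp at e1
    have hne : A' * B ≠ 0 := hpro ▸ mul_ne_zero hA0 hb'
    have := hB (right_ne_zero_of_mul hne)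
    have hdeg := congrArg natDegree hpro
    rw [natDegree_mul hA0 hb', natDegree_mul (left_ne_zero_of_mul hne)
      (right_ne_zero_of_mul hne)] at hdeg
    omega
  · have hA0 : A' ≠ 0 := by rintro rfl; simp at e2
    have hne : A * B' ≠ 0 := hpro ▸ mul_ne_zero hA0 hb
    have := hB' (right_ne_zero_of_mul hne)
    have hdeg := congrArg natDegree hpro
    rw [natDegree_mul hA0 hb, natDegree_mul (left_ne_zero_of_mul hne)
      (right_ne_zero_of_mul hne)] at hdeg
    omega
  · omega

theorem PowerSeries.X_dvd_of_mul_eq_mul {u v s t : PowerSeries k}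
    (hs : PowerSeries.X ^ n ∣ s) (hs' : ¬ PowerSeries.X ^ (n + 1) ∣ s)
    (ht : PowerSeries.X ^ (n + 2) ∣ t) (h : v * s = u * t) : PowerSeries.X ∣ v := by
  obtain ⟨s, rfl⟩ := hs
  obtain ⟨t, rfl⟩ := ht
  have hX : (PowerSeries.X : PowerSeries k) ≠ 0 := PowerSeries.X_ne_zero
  have h1 : v * s = PowerSeries.X * (PowerSeries.X * (u * t)) := by
    apply mul_left_cancel₀ (pow_ne_zero n hX)
    linear_combination h
  rcases PowerSeries.X_prime.dvd_or_dvd ⟨_, h1⟩ with h2 | ⟨r, rfl⟩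
  · exact h2
  · exact absurd ⟨r, by ring⟩ hs'

/-- The two pairs are proportional over `k(x)`. If the first vanishes to order exactly `n` at `p`,
the second, of order at least `n + 2`, must be divisible by `x`; dividing costs one zero at `p` and
saves two poles at `q`. -/
theorem HasInterpolant.of_neighbours (hd : d < γ) (h : HasInterpolant γ a n d)
    (h' : HasInterpolant γ a (n + 2) d) : HasInterpolant γ a (n + 1) d := by
  obtain ⟨A, B, h0, hA, hB, hv⟩ := h
  obtain ⟨A', B', h0', hA', hB', hv'⟩ := h'
  by_cases hv1 : (PowerSeries.X : PowerSeries k) ^ (n + 1) ∣ (A : PowerSeries k) + a * B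
  · exact ⟨A, B, h0, by omega, fun h => by have := hB h; omega, hv1⟩
  have hpro := interpolants_proportional hA hB hA' hB' hv
    ((pow_dvd_pow _ (by omega : n ≤ n + 2)).trans hv') (by omega)
  have hpro' : (A : PowerSeries k) * B' = A' * B := by
    exact_mod_cast congrArg (fun P : k[X] => (P : PowerSeries k)) hpro
  have hXA : (X : k[X]) ∣ A' := by
    rw [← pow_one X, ← PowerSeries.X_pow_dvd_coe_iff, pow_one]
    refine PowerSeries.X_dvd_of_mul_eq_mul hv hv1 hv' (u := A) ?_
    linear_combination (-a) * hpro'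
  have hXB : (X : k[X]) ∣ B' := by
    rw [← pow_one X, ← PowerSeries.X_pow_dvd_coe_iff, pow_one]
    refine PowerSeries.X_dvd_of_mul_eq_mul hv hv1 hv' (u := B) ?_
    linear_combination hpro'
  obtain ⟨A', rfl⟩ := hXA
  obtain ⟨B', rfl⟩ := hXB
  refine ⟨A', B', by simpa using h0', ?_, fun hb => ?_, ?_⟩
  · by_cases hA0 : A' = 0
    · simp [hA0]
    · rw [natDegree_X_mul hA0] at hA'
      omega
  · have := hB' (mul_ne_zero X_ne_zero hb)
    rw [natDegree_X_mul hb] at this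
    omega
  · have : ((X * A' : k[X]) : PowerSeries k) + a * ((X * B' : k[X]) : PowerSeries k)
        = PowerSeries.X * ((A' : PowerSeries k) + a * (B' : PowerSeries k)) := by
      push_cast; ring
    rw [this, show n + 2 = (n + 1) + 1 from rfl, pow_succ'] at hv'
    exact (mul_dvd_mul_iff_left PowerSeries.X_ne_zero).1 hv'

theorem HasInterpolant.of_three (hd : d + 1 < γ) (h0 : HasInterpolant γ a n (d + 1))
    (h1 : HasInterpolant γ a (n + 1) (d + 1)) (h2 : HasInterpolant γ a (n + 2) (d + 1)) :
    HasInterpolant γ a (n + 1) d := by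
  rcases h0.or_of_consecutive hd h1 with h | h
  · rcases h1.or_of_consecutive hd h2 with h' | h'
    · exact h'
    · exact h.of_neighbours (by omega) h'
  · exact h

/-- The interpolants of defect `d < γ` are determined by those of defect `γ - 1`. -/
theorem hasInterpolant_iff_window {i : ℕ} (hd : d + i + 1 = γ) (hi : i ≤ n) :
    HasInterpolant γ a n d ↔
      ∀ m, n ≤ m + i → m ≤ n + i → HasInterpolant γ a m (γ - 1) := by
  induction i generalizing d n with
  | zero =>
    refine ⟨fun h m h1 h2 => ?_, fun h => ?_⟩
    · obtain rfl : m = n := by omega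
      exact h.mono (by omega)
    · exact (h n (by omega) (by omega)).mono (by omega)
  | succ i ih =>
    obtain ⟨n, rfl⟩ : ∃ l, n = l + 1 := ⟨n - 1, by omega⟩
    constructor
    · intro h m h1 h2
      -- The windows of radius `i` around `n`, `n + 1`, `n + 2` together cover the window of radius
      -- `i + 1` around `n + 1`.
      have a0 := (ih (d := d + 1) (n := n) (by omega) (by omega)).1 h.pred
      have a2 := (ih (d := d + 1) (n := n + 1 + 1) (by omega) (by omega)).1 h.succ
      have a1 := (ih (d := d + 1) (n := n + 1) (by omega) (by omega)).1 (h.mono (by omega))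
      by_cases hm : m ≤ n + i
      · exact a0 m (by omega) hm
      · by_cases hm' : m ≤ n + 1 + i
        · exact a1 m (by omega) hm'
        · exact a2 m (by omega) (by omega)
    · intro h
      refine HasInterpolant.of_three (by omega)
        ((ih (by omega) (by omega)).2 fun m h1 h2 => h m (by omega) (by omega))
        ((ih (by omega) (by omega)).2 fun m h1 h2 => h m (by omega) (by omega))
        ((ih (by omega) (by omega)).2 fun m h1 h2 => h m (by omega) (by omega))

theorem hasInterpolant_of_le (h : n ≤ d) : HasInterpolant γ a n d :=
  ⟨X ^ n, 0, Or.inl (pow_ne_zero _ X_ne_zero), by rw [natDegree_X_pow]; omega,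
    fun h => absurd rfl h, by simp⟩

/-- Here `n + d ≤ 2γ` is less than the pole order of `y`, which forces `B = 0`; then `X ^ n` divides
`A`, so `2n ≤ n + d`. -/
theorem hasInterpolant_iff_of_le (hn : n ≤ γ + 1) (hd : d < γ) :
    HasInterpolant γ a n d ↔ n ≤ d := by
  refine ⟨fun h => ?_, hasInterpolant_of_le⟩
  by_contra! hlt
  obtain ⟨A, B, h0, hA, hB, hv⟩ := h
  obtain rfl : B = 0 := by
    by_contra hb
    have := hB hb
    omega
  have hA0 : A ≠ 0 := by simpa using h0
  simp only [Polynomial.coe_zero, mul_zero, add_zero, PowerSeries.X_pow_dvd_coe_iff] at hv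
  have := natDegree_le_of_dvd hv hA0
  rw [natDegree_X_pow] at this
  omega

/-! ### Hankel determinants and parameter counts. -/

theorem coeff_mul_coe_eq_sum {s : ℕ} {B : k[X]} (hB : B.degree < s) (m : ℕ) (hm : s ≤ m + 1) :
    PowerSeries.coeff m (a * (B : PowerSeries k)) =
      ∑ l : Fin s, B.coeff l * PowerSeries.coeff (m - l) a := by
  rw [mul_comm, PowerSeries.coeff_mul, Finset.Nat.sum_antidiagonal_eq_sum_range_succ_mk,
    Fin.sum_univ_eq_sum_range (fun l => B.coeff l * PowerSeries.coeff (m - l) a) s]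
  simp only [Polynomial.coeff_coe]
  symm
  refine Finset.sum_subset (Finset.range_subset_range.2 hm) fun l _ hl => ?_
  rw [coeff_eq_zero_of_degree_lt (hB.trans_le (by simpa using hl)), zero_mul]

/-- The polynomial `B` can be completed to a pair `(A, B)` with `deg A < r` and
`X ^ n ∣ A + a B` if and only if certain coefficients of `a B` vanish. -/
theorem exists_degree_lt_and_dvd_iff {B : k[X]} {r n : ℕ} :
    (∃ A : k[X], A.degree < r ∧
      (PowerSeries.X : PowerSeries k) ^ n ∣ (A : PowerSeries k) + a * (B : PowerSeries k)) ↔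
      ∀ m, r ≤ m → m < n → PowerSeries.coeff m (a * (B : PowerSeries k)) = 0 := by
  constructor
  · rintro ⟨A, hA, hv⟩ m h1 h2
    have := PowerSeries.X_pow_dvd_iff.1 hv m h2
    rwa [map_add, Polynomial.coeff_coe,
      coeff_eq_zero_of_degree_lt (hA.trans_le (by exact_mod_cast h1)), zero_add] at this
  · intro h
    refine ⟨-PowerSeries.trunc r (a * (B : PowerSeries k)), ?_, ?_⟩
    · rw [degree_neg]
      exact PowerSeries.degree_trunc_lt _ _
    · rw [PowerSeries.X_pow_dvd_iff]
      intro m hm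
      rw [map_add, Polynomial.coeff_coe, coeff_neg, PowerSeries.coeff_trunc]
      split_ifs with hmr
      · ring
      · rw [h m (by omega) hm]; ring

/-- A kernel vector, read in reverse order, is the coefficient vector of `B`: row `i` of the system
is then the coefficient of `a B` at `c + s - 1 + i`. The bounds on `m + 1` encode this range without
natural subtraction. -/
theorem hankel_det_eq_zero_iff {c s : ℕ} :
    (Matrix.of fun i j : Fin s => PowerSeries.coeff (c + (i : ℕ) + (j : ℕ)) a).det = 0 ↔
      ∃ B : k[X], B ≠ 0 ∧ B.degree < s ∧ ∀ m, c + s ≤ m + 1 → m + 1 < c + 2 * s →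
        PowerSeries.coeff m (a * (B : PowerSeries k)) = 0 := by
  rw [← Matrix.exists_mulVec_eq_zero_iff]
  constructor
  · rintro ⟨v, hv0, hv⟩
    have hc : ∀ l : Fin s, (∑ j : Fin s, monomial (j.rev : ℕ) (v j)).coeff l = v l.rev := by
      intro l
      simp only [finsetSum_coeff, coeff_monomial]
      rw [Finset.sum_eq_single l.rev]
      · simp
      · intro j _ hj
        rw [if_neg]
        intro h
        exact hj (by rw [← Fin.ext h, Fin.rev_rev])
      · simp
    have hdeg : (∑ j : Fin s, monomial (j.rev : ℕ) (v j)).degree < s := by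
      refine (degree_sum_le _ _).trans_lt ((Finset.sup_lt_iff (WithBot.bot_lt_coe _)).2 ?_)
      intro j _
      exact (degree_monomial_le _ _).trans_lt (by exact_mod_cast j.rev.2)
    refine ⟨∑ j : Fin s, monomial (j.rev : ℕ) (v j), fun h0 => hv0 ?_, hdeg, fun m h1 h2 => ?_⟩
    · ext l
      have := hc l.rev
      rw [h0, Fin.rev_rev] at this
      simpa using this.symm
    · rw [coeff_mul_coe_eq_sum hdeg m (by omega)]
      have := congrFun hv ⟨m + 1 - (c + s), by omega⟩
      simp only [Matrix.mulVec, dotProduct, Matrix.of_apply, Pi.zero_apply] at this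
      rw [← this, ← Equiv.sum_comp Fin.revPerm]
      refine Finset.sum_congr rfl fun j _ => ?_
      rw [hc, Fin.revPerm_apply, Fin.rev_rev, mul_comm]
      congr 3
      rw [Fin.val_rev]
      omega
  · rintro ⟨B, hB0, hdeg, hB⟩
    refine ⟨fun j => B.coeff j.rev, fun h0 => hB0 ?_, ?_⟩
    · ext l
      by_cases hl : l < s
      · have := congrFun h0 (Fin.rev ⟨l, hl⟩)
        simpa using this
      · rw [coeff_eq_zero_of_degree_lt (hdeg.trans_le (by exact_mod_cast not_lt.1 hl)), coeff_zero]
    · ext i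
      have := hB (c + s - 1 + i) (by omega) (by omega)
      rw [coeff_mul_coe_eq_sum hdeg _ (by omega), ← Equiv.sum_comp Fin.revPerm] at this
      simp only [Matrix.mulVec, dotProduct, Matrix.of_apply, Pi.zero_apply]
      rw [← this]
      refine Finset.sum_congr rfl fun j _ => ?_
      rw [Fin.revPerm_apply, mul_comm]
      congr 3
      rw [Fin.val_rev]
      omega

theorem natDegree_le_iff_degree_lt {B : k[X]} {N s : ℕ} (h : s = N + 1) :
    B.natDegree ≤ N ↔ B.degree < s := by
  subst h
  rw [natDegree_le_iff_degree_le]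
  by_cases hB : B = 0
  · simp [hB]
  · rw [degree_eq_natDegree hB]
    norm_cast
    omega

/-- In both parities, the pole bound `n + γ - 1` amounts to `deg A ≤ c + s - 2` and `deg B ≤ s - 1`.
What remains is the vanishing of the `s` coefficients of `a B` from `c + s - 1` to `n - 1`. -/
theorem hasInterpolant_iff_hankel {c s : ℕ} (hs : 1 ≤ s) (hc : γ + 1 ≤ c) (hc' : c ≤ γ + 2)
    (hn : n + 1 = c + 2 * s) (hd : d + 1 = γ) :
    HasInterpolant γ a n d ↔
      (Matrix.of fun i j : Fin s => PowerSeries.coeff (c + (i : ℕ) + (j : ℕ)) a).det = 0 := by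
  rw [hankel_det_eq_zero_iff]
  constructor
  · rintro ⟨A, B, h0, hA, hB, hv⟩
    have hA' : A.degree < (c + s - 1 : ℕ) :=
      (natDegree_le_iff_degree_lt (N := c + s - 2) (by omega)).1 (by omega)
    have hB0 : B ≠ 0 := by
      rintro rfl
      simp only [Polynomial.coe_zero, mul_zero, add_zero, PowerSeries.X_pow_dvd_coe_iff] at hv
      have hA0 : A ≠ 0 := by simpa using h0
      have := natDegree_le_of_dvd hv hA0
      rw [natDegree_X_pow] at this
      omega
    have := hB hB0
    refine ⟨B, hB0, (natDegree_le_iff_degree_lt (N := s - 1) (by omega)).1 (by omega),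
      fun m h1 h2 => ?_⟩
    exact (exists_degree_lt_and_dvd_iff (r := c + s - 1) (n := n)).1 ⟨A, hA', hv⟩ m
      (by omega) (by omega)
  · rintro ⟨B, hB0, hdeg, hB⟩
    obtain ⟨A, hA, hv⟩ := (exists_degree_lt_and_dvd_iff (a := a) (r := c + s - 1) (n := n)).2
      fun m h1 h2 => hB m (by omega) (by omega)
    have h1 := (natDegree_le_iff_degree_lt (N := c + s - 2) (by omega)).2 hA
    have h2 := (natDegree_le_iff_degree_lt (N := s - 1) (by omega)).2 hdeg
    exact ⟨A, B, Or.inr hB0, by omega, fun _ => by omega, hv⟩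

theorem hasInterpolant_iff_hankelDet (hd : d + 1 = γ) (hn : γ + 2 ≤ n) :
    HasInterpolant γ a n d ↔ hankelDet γ a n = 0 := by
  unfold hankelDet
  split_ifs with h
  · obtain ⟨r, hr⟩ := h
    exact hasInterpolant_iff_hankel (by omega) (by omega) (by omega) (by omega) hd
  · obtain ⟨r, hr⟩ := Nat.not_odd_iff_even.1 h
    exact hasInterpolant_iff_hankel (by omega) (by omega) (by omega) (by omega) hd

/-- By counting parameters there is always an interpolant of defect `γ`. -/
theorem hasInterpolant_genus (n : ℕ) : HasInterpolant γ a n γ := by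
  by_cases hn : n ≤ γ
  · exact hasInterpolant_of_le hn
  push Not at hn
  -- `s` is the number of coefficients the pole bound allows for `B`; taking `deg A < r` leaves only
  -- `n - r = s - 1` linear conditions.
  set s := (n - γ - 1) / 2 + 1 with hs
  set r := n + 1 - s with hr
  let T : degreeLT k s →ₗ[k] (Fin (s - 1) → k) :=
    LinearMap.pi fun i => (PowerSeries.coeff (r + i)).comp
      ((LinearMap.mulLeft k a).comp ((Polynomial.coeToPowerSeries.algHom k).toLinearMap.comp
        (degreeLT k s).subtype))
  have hker : LinearMap.ker T ≠ ⊥ := by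
    apply LinearMap.ker_ne_bot_of_finrank_lt
    rw [(degreeLTEquiv k s).finrank_eq]
    simp
    omega
  obtain ⟨⟨B, hBmem⟩, hBT, hB0⟩ := Submodule.exists_mem_ne_zero_of_ne_bot hker
  have hB0' : B ≠ 0 := fun h => hB0 (by simp [h])
  have hdeg := mem_degreeLT.1 hBmem
  have hB : ∀ m, r ≤ m → m < n → PowerSeries.coeff m (a * (B : PowerSeries k)) = 0 := by
    intro m h1 h2
    have := congrFun (LinearMap.mem_ker.1 hBT) ⟨m - r, by omega⟩
    simpa [T, show r + (m - r) = m by omega] using this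
  obtain ⟨A, hA, hv⟩ := (exists_degree_lt_and_dvd_iff (a := a)).2 hB
  have h1 := (natDegree_le_iff_degree_lt (N := r - 1) (by omega)).2 hA
  have h2 := (natDegree_le_iff_degree_lt (N := s - 1) (by omega)).2 hdeg
  exact ⟨A, B, Or.inr hB0', by omega, fun _ => by omega, hv⟩

/-- The existence of interpolants is determined by the vanishing pattern of the determinants. -/
theorem hasInterpolant_congr {k' : Type*} [Field k'] {a' : PowerSeries k'} (hγ : 1 ≤ γ)
    (h : ∀ m, γ + 2 ≤ m → (hankelDet γ a m = 0 ↔ hankelDet γ a' m = 0)) (n d : ℕ) :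
    HasInterpolant γ a n d ↔ HasInterpolant γ a' n d := by
  have key : ∀ m, HasInterpolant γ a m (γ - 1) ↔ HasInterpolant γ a' m (γ - 1) := by
    intro m
    by_cases hm : γ + 2 ≤ m
    · rw [hasInterpolant_iff_hankelDet (by omega) hm, hasInterpolant_iff_hankelDet (by omega) hm,
        h m hm]
    · rw [hasInterpolant_iff_of_le (by omega) (by omega),
        hasInterpolant_iff_of_le (by omega) (by omega)]
  by_cases hd : d < γ
  · by_cases hn : n ≤ γ + 1
    · rw [hasInterpolant_iff_of_le hn hd, hasInterpolant_iff_of_le hn hd]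
    · rw [hasInterpolant_iff_window (i := γ - 1 - d) (by omega) (by omega),
        hasInterpolant_iff_window (i := γ - 1 - d) (by omega) (by omega)]
      simp only [key]
  · push Not at hd
    exact ⟨fun _ => (hasInterpolant_genus n).mono hd, fun _ => (hasInterpolant_genus n).mono hd⟩

end Interpolant

namespace OddHyperellipticCurve

/-! ### The function field, its involution, and integral elements. -/

section FunctionField

variable {k : Type*} [Field k] {γ : ℕ} (C : OddHyperellipticCurve k γ)

theorem aeval_x (A : k[X]) :
    aeval C.x A = AdjoinRoot.of C.poly (algebraMap k[X] (RatFunc k) A) := by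
  have h1 : aeval C.x A = AdjoinRoot.of C.poly (aeval RatFunc.X A) := by
    rw [x, aeval_def, aeval_def, hom_eval₂]
    rfl
  rw [h1, RatFunc.aeval_X_left_eq_algebraMap]

theorem algebraMap_polynomial_eq (A : k[X]) :
    algebraMap k[X] C.FunctionField A = aeval C.x A := by
  rw [aeval_x]
  rfl

theorem aeval_x_injective : Function.Injective (aeval C.x : k[X] →ₐ[k] C.FunctionField) := by
  intro A B h
  rw [aeval_x, aeval_x] at h
  exact RatFunc.algebraMap_injective k ((AdjoinRoot.of C.poly).injective h)

theorem aeval_x_ne_zero {A : k[X]} : aeval C.x A ≠ 0 ↔ A ≠ 0 :=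
  map_ne_zero_iff _ C.aeval_x_injective

theorem f_ne_zero : C.f ≠ 0 := fun h => by
  have := C.natDegree_f
  simp [h] at this

theorem exists_of_add_of_mul_y (h : C.FunctionField) :
    ∃ u v : RatFunc k, h = AdjoinRoot.of C.poly u + AdjoinRoot.of C.poly v * C.y := by
  obtain ⟨g, rfl⟩ := AdjoinRoot.mk_surjective h
  have hm : C.poly.Monic := monic_X_pow_sub_C _ two_ne_zero
  have hdeg : (g %ₘ C.poly).degree < 2 := by
    refine (degree_modByMonic_lt g hm).trans_eq ?_
    exact degree_X_pow_sub_C two_pos _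
  have hg : AdjoinRoot.mk C.poly g = AdjoinRoot.mk C.poly (g %ₘ C.poly) := by
    rw [AdjoinRoot.mk_eq_mk]
    exact ⟨g /ₘ C.poly, by linear_combination -(modByMonic_add_div g C.poly)⟩
  have hlin := eq_X_add_C_of_degree_le_one (p := g %ₘ C.poly)
    (Order.le_of_lt_succ (by exact_mod_cast hdeg))
  refine ⟨(g %ₘ C.poly).coeff 0, (g %ₘ C.poly).coeff 1, ?_⟩
  rw [hg, hlin]
  simp [y, AdjoinRoot.mk_C]
  ring

theorem exists_mul_aeval_eq (h : C.FunctionField) :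
    ∃ A B D : k[X], D ≠ 0 ∧ h * aeval C.x D = aeval C.x A + aeval C.x B * C.y := by
  obtain ⟨u, v, rfl⟩ := C.exists_of_add_of_mul_y h
  refine ⟨u.num * v.denom, v.num * u.denom, u.denom * v.denom,
    mul_ne_zero u.denom_ne_zero v.denom_ne_zero, ?_⟩
  have hu : u * algebraMap k[X] (RatFunc k) u.denom = algebraMap k[X] (RatFunc k) u.num := by
    have := u.num_div_denom
    rwa [div_eq_iff (RatFunc.algebraMap_ne_zero u.denom_ne_zero), eq_comm] at this
  have hv : v * algebraMap k[X] (RatFunc k) v.denom = algebraMap k[X] (RatFunc k) v.num := by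
    have := v.num_div_denom
    rwa [div_eq_iff (RatFunc.algebraMap_ne_zero v.denom_ne_zero), eq_comm] at this
  simp only [aeval_x, map_mul, ← hu, ← hv]
  ring

/-- Every nonzero function is, up to factors in `k(x)`, of the form `A + B y` with `A` and `B`
coprime. -/
theorem exists_isCoprime_mul_aeval_eq {h : C.FunctionField} (h0 : h ≠ 0) :
    ∃ A B D G : k[X], D ≠ 0 ∧ G ≠ 0 ∧ IsCoprime A B ∧
      h * aeval C.x D = aeval C.x G * (aeval C.x A + aeval C.x B * C.y) := by
  classical
  obtain ⟨A, B, D, hD, hh⟩ := C.exists_mul_aeval_eq h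
  have hne : ¬(A = 0 ∧ B = 0) := by
    rintro ⟨rfl, rfl⟩
    exact mul_ne_zero h0 (C.aeval_x_ne_zero.2 hD) (by simpa using hh)
  have hG : EuclideanDomain.gcd A B ≠ 0 := fun h => hne (EuclideanDomain.gcd_eq_zero_iff.1 h)
  obtain ⟨A', hA'⟩ := EuclideanDomain.gcd_dvd_left A B
  obtain ⟨B', hB'⟩ := EuclideanDomain.gcd_dvd_right A B
  refine ⟨A', B', D, EuclideanDomain.gcd A B, hD, hG, ?_, ?_⟩
  · refine ⟨EuclideanDomain.gcdA A B, EuclideanDomain.gcdB A B, mul_left_cancel₀ hG ?_⟩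
    have := EuclideanDomain.gcd_eq_gcd_ab A B
    linear_combination -this - EuclideanDomain.gcdA A B * hA' - EuclideanDomain.gcdB A B * hB'
  · rw [hh, mul_add, ← mul_assoc, ← map_mul, ← map_mul, ← hA', ← hB']

theorem norm_eq (A B : k[X]) :
    (aeval C.x A + aeval C.x B * C.y) * (aeval C.x A - aeval C.x B * C.y) =
      aeval C.x (A ^ 2 - C.f * B ^ 2) := by
  simp only [map_sub, map_mul, map_pow, ← C.y_sq]
  ring

/-- The hyperelliptic involution `y ↦ -y`, on functions. -/
noncomputable def conj : C.FunctionField →ₐ[RatFunc k] C.FunctionField :=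
  AdjoinRoot.liftAlgHom C.poly (Algebra.ofId (RatFunc k) C.FunctionField) (-C.y) (by
    have h : eval₂ (AdjoinRoot.of C.poly) (AdjoinRoot.root C.poly)
      (X ^ 2 - Polynomial.C (algebraMap k[X] (RatFunc k) C.f)) = 0 := AdjoinRoot.eval₂_root C.poly
    rw [eval₂_sub, eval₂_pow, eval₂_X, eval₂_C] at h
    change eval₂ _ _ (X ^ 2 - Polynomial.C (algebraMap k[X] (RatFunc k) C.f)) = 0
    rw [eval₂_sub, eval₂_pow, eval₂_X, eval₂_C, neg_sq]
    exact h)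

@[simp] theorem conj_of (u : RatFunc k) :
    C.conj (AdjoinRoot.of C.poly u) = AdjoinRoot.of C.poly u := C.conj.commutes u

@[simp] theorem conj_y : C.conj C.y = -C.y := AdjoinRoot.liftAlgHom_root ..

@[simp] theorem conj_x : C.conj C.x = C.x := C.conj_of _

@[simp] theorem conj_aeval_x (A : k[X]) : C.conj (aeval C.x A) = aeval C.x A := by
  rw [aeval_x, conj_of]

@[simp] theorem conj_algebraMap (c : k) :
    C.conj (algebraMap k C.FunctionField c) = algebraMap k C.FunctionField c := by
  rw [← aeval_C C.x c, conj_aeval_x]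

@[simp] theorem conj_conj (h : C.FunctionField) : C.conj (C.conj h) = h := by
  obtain ⟨u, v, rfl⟩ := C.exists_of_add_of_mul_y h
  simp

/-- A function that is integral over `k[x]` lies in `k[x] + k[x] y`. -/
theorem exists_eq_of_isIntegral [CharZero k] {h : C.FunctionField} (hh : IsIntegral k[X] h) :
    ∃ A B : k[X], h = aeval C.x A + aeval C.x B * C.y := by
  obtain ⟨u, v, rfl⟩ := C.exists_of_add_of_mul_y h
  have hconj : IsIntegral k[X] (C.conj (AdjoinRoot.of C.poly u + AdjoinRoot.of C.poly v * C.y)) :=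
    hh.map (C.conj.restrictScalars k[X])
  have h2 : (2 : k) ≠ 0 := two_ne_zero
  have hhalf : algebraMap k C.FunctionField 2⁻¹ * 2 = 1 := by
    rw [← map_ofNat (algebraMap k C.FunctionField) 2, ← map_mul, inv_mul_cancel₀ h2, map_one]
  have hc : IsIntegral k[X] (algebraMap k C.FunctionField 2⁻¹) := by
    have : algebraMap k C.FunctionField 2⁻¹ =
        algebraMap k[X] C.FunctionField (Polynomial.C 2⁻¹) := by
      rw [algebraMap_polynomial_eq, aeval_C]
    rw [this]
    exact isIntegral_algebraMap
  have hof : ∀ w : RatFunc k, IsIntegral k[X] (AdjoinRoot.of C.poly w) →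
      ∃ A : k[X], algebraMap k[X] (RatFunc k) A = w := by
    intro w hw
    have : IsIntegral k[X] w :=
      (isIntegral_algebraMap_iff (A := RatFunc k) (AdjoinRoot.of C.poly).injective).1 hw
    exact IsIntegrallyClosed.isIntegral_iff.1 this
  -- `u` is half the trace of `h`, so it is integral and hence a polynomial.
  have hu : IsIntegral k[X] (AdjoinRoot.of C.poly u) := by
    have e : AdjoinRoot.of C.poly u = algebraMap k C.FunctionField 2⁻¹ *
        (AdjoinRoot.of C.poly u + AdjoinRoot.of C.poly v * C.y +
          C.conj (AdjoinRoot.of C.poly u + AdjoinRoot.of C.poly v * C.y)) := by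
      simp only [map_add, map_mul, conj_of, conj_y]
      linear_combination -(AdjoinRoot.of C.poly u) * hhalf
    rw [e]
    exact hc.mul (hh.add hconj)
  obtain ⟨A, rfl⟩ := hof u hu
  have hv : IsIntegral k[X] (AdjoinRoot.of C.poly v * C.y) := by
    rw [← add_sub_cancel_left (AdjoinRoot.of C.poly (algebraMap k[X] (RatFunc k) A))
      (AdjoinRoot.of C.poly v * C.y)]
    exact hh.sub hu
  have hv2 : IsIntegral k[X] (AdjoinRoot.of C.poly (v ^ 2 * algebraMap k[X] (RatFunc k) C.f)) := by
    rw [map_mul, map_pow, ← aeval_x, ← y_sq, ← mul_pow]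
    exact hv.pow 2
  obtain ⟨N, hN⟩ := hof _ hv2
  -- `v² f` is a polynomial, so the square of the denominator of `v` divides the squarefree `f`.
  have hden : IsUnit v.denom := by
    refine C.squarefree_f _ ?_
    have hcop : IsCoprime (v.denom * v.denom) (v.num ^ 2) := by
      rw [← pow_two]
      exact v.isCoprime_num_denom.symm.pow
    refine hcop.dvd_of_dvd_mul_left (z := C.f) ⟨N, ?_⟩
    apply RatFunc.algebraMap_injective k
    have hv' : algebraMap k[X] (RatFunc k) v.num = v * algebraMap k[X] (RatFunc k) v.denom := by
      have := v.num_div_denom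
      rwa [div_eq_iff (RatFunc.algebraMap_ne_zero v.denom_ne_zero)] at this
    simp only [map_mul, map_pow, hN, hv']
    ring
  obtain ⟨c, hc0, hcd⟩ := Polynomial.isUnit_iff.1 hden
  refine ⟨A, v.num * Polynomial.C c⁻¹, ?_⟩
  have hv' : algebraMap k[X] (RatFunc k) (v.num * Polynomial.C c⁻¹) = v := by
    have hc1 : v.denom * Polynomial.C c⁻¹ = 1 := by
      rw [← hcd, ← Polynomial.C_mul, mul_inv_cancel₀ hc0.ne_zero, Polynomial.C_1]
    have := v.num_div_denom
    rw [div_eq_iff (RatFunc.algebraMap_ne_zero v.denom_ne_zero)] at this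
    rw [map_mul, this, mul_assoc, ← map_mul, hc1, map_one, mul_one]
  rw [aeval_x, aeval_x, hv']

end FunctionField

/-! ### Existence of points, via the integral closure of `k[x]`. -/

section Existence

variable {k : Type*} [Field k] [CharZero k] {γ : ℕ} (C : OddHyperellipticCurve k γ)

/-- A function without poles at the finite points is integral over `k[x]`. -/
theorem isIntegral_of_forall_point {h : C.FunctionField}
    (hh : ∀ P : C.Point, P.val C.x ≤ 1 → P.val h ≤ 1) : IsIntegral k[X] h := by
  have hfin : FiniteDimensional (RatFunc k) C.FunctionField :=
    (AdjoinRoot.powerBasis C.irreducible_poly.ne_zero).finite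
  have : CharZero (RatFunc k) :=
    charZero_of_injective_algebraMap (algebraMap k (RatFunc k)).injective
  have hsep : Algebra.IsSeparable (RatFunc k) C.FunctionField := inferInstance
  have := integralClosure.isDedekindDomain k[X] (RatFunc k) C.FunctionField
  have := integralClosure.isFractionRing_of_finite_extension (A := k[X]) (RatFunc k)
    C.FunctionField
  -- Every height-one prime of the integral closure, a Dedekind domain, gives a point at which `x`
  -- is finite, so `h` is integral at all of them.
  obtain ⟨r, hr⟩ := IsDedekindDomain.HeightOneSpectrum.mem_integers_of_valuation_le_one
    (R := integralClosure k[X] C.FunctionField) C.FunctionField h (fun v => by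
      have hle : ∀ A : k[X], v.valuation C.FunctionField (aeval C.x A) ≤ 1 := fun A => by
        rw [← algebraMap_polynomial_eq]
        exact v.valuation_le_one (algebraMap k[X] (integralClosure k[X] C.FunctionField) A)
      refine hh ⟨v.valuation C.FunctionField, v.valuation_surjective C.FunctionField,
        fun c hc => le_antisymm (by simpa using hle (Polynomial.C c)) ?_⟩ (by simpa using hle X)
      have := hle (Polynomial.C c⁻¹)
      rw [aeval_C, map_inv₀, map_inv₀] at this
      refine (inv_le_one₀ ?_).1 this
      rw [Valuation.pos_iff]
      simpa using hc)
  rw [← hr]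
  exact r.2

theorem exists_eq_of_forall_point {h : C.FunctionField}
    (hh : ∀ P : C.Point, P.val C.x ≤ 1 → P.val h ≤ 1) :
    ∃ A B : k[X], h = aeval C.x A + aeval C.x B * C.y :=
  C.exists_eq_of_isIntegral (C.isIntegral_of_forall_point hh)

/-- There is a point over every finite value of `x`. -/
theorem exists_point_over (a : k) :
    ∃ P : C.Point, P.val (C.x - algebraMap k C.FunctionField a) < 1 := by
  by_contra! hcon
  have hx : C.x - algebraMap k C.FunctionField a = aeval C.x (X - Polynomial.C a) := by simp
  -- Without a point over `a`, the function `1 / (x - a)` has no finite pole and would be a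
  -- polynomial in `x`.
  have h1 : IsIntegral k[X] (aeval C.x (X - Polynomial.C a))⁻¹ := by
    refine C.isIntegral_of_forall_point fun P _ => ?_
    rw [map_inv₀, ← hx]
    exact inv_le_one_of_one_le₀ (hcon P)
  rw [aeval_x, ← map_inv₀] at h1
  have h2 : IsIntegral k[X] (algebraMap k[X] (RatFunc k) (X - Polynomial.C a))⁻¹ :=
    (isIntegral_algebraMap_iff (A := RatFunc k) (AdjoinRoot.of C.poly).injective).1 h1
  obtain ⟨A, hA⟩ := IsIntegrallyClosed.isIntegral_iff.1 h2
  have h3 : A * (X - Polynomial.C a) = 1 := by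
    apply RatFunc.algebraMap_injective k
    rw [map_mul, hA, map_one, inv_mul_cancel₀]
    exact RatFunc.algebraMap_ne_zero (X_sub_C_ne_zero a)
  exact not_isUnit_X_sub_C a (IsUnit.of_mul_eq_one_right _ h3)

end Existence

end OddHyperellipticCurve

theorem Polynomial.induction_of_isAlgClosed {k : Type*} [Field k] [IsAlgClosed k] {M : k[X] → Prop}
    (hC : ∀ c : k, c ≠ 0 → M (C c)) (hX : ∀ a : k, M (X - C a))
    (hmul : ∀ A B : k[X], M A → M B → M (A * B)) {A : k[X]} (hA : A ≠ 0) : M A := by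
  rw [(IsAlgClosed.splits A).eq_prod_roots]
  refine hmul _ _ (hC _ (leadingCoeff_ne_zero.2 hA)) ?_
  induction A.roots using Multiset.induction with
  | empty => simpa using hC 1 one_ne_zero
  | cons a s ih =>
    rw [Multiset.map_cons, Multiset.prod_cons]
    exact hmul _ _ (hX a) ih

namespace OddHyperellipticCurve

/-! ### Classification of points and their local parameters. -/

section Points

variable {k : Type*} [Field k] {γ : ℕ} {C : OddHyperellipticCurve k γ}

instance Point.isTrivialOn (P : C.Point) : P.val.IsTrivialOn k := ⟨P.trivial_on_constants⟩

/-- The function `x - a` vanishes at `P`. -/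
def Point.LiesOver (P : C.Point) (a : k) : Prop :=
  P.val (C.x - algebraMap k C.FunctionField a) < 1

theorem Point.val_algebraMap_le_one (P : C.Point) (c : k) :
    P.val (algebraMap k C.FunctionField c) ≤ 1 := by
  by_cases hc : c = 0
  · simp [hc]
  · exact (P.trivial_on_constants c hc).le

theorem Point.val_aeval_le_one {P : C.Point} (hx : P.val C.x ≤ 1) (A : k[X]) :
    P.val (aeval C.x A) ≤ 1 := by
  induction A using Polynomial.induction_on' with
  | add A B hA hB =>
    rw [map_add]
    exact P.val.map_add_le hA hB
  | monomial n c =>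
    rw [aeval_monomial, map_mul, map_pow]
    exact mul_le_one' (P.val_algebraMap_le_one c) (pow_le_one' hx n)

theorem Point.val_y_le_one {P : C.Point} (hx : P.val C.x ≤ 1) : P.val C.y ≤ 1 := by
  have h := Point.val_aeval_le_one hx C.f
  rw [← C.y_sq, map_pow] at h
  exact (pow_le_one_iff two_ne_zero).1 h

theorem Point.LiesOver.val_x_le_one {P : C.Point} {a : k} (h : P.LiesOver a) : P.val C.x ≤ 1 := by
  rw [← sub_add_cancel C.x (algebraMap k C.FunctionField a)]
  exact P.val.map_add_le (le_of_lt h) (P.val_algebraMap_le_one a)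

theorem Point.LiesOver.val_aeval_sub_lt_one {P : C.Point} {a : k} (h : P.LiesOver a) (A : k[X]) :
    P.val (aeval C.x A - algebraMap k C.FunctionField (A.eval a)) < 1 := by
  obtain ⟨B, hB⟩ := X_sub_C_dvd_sub_C_eval (a := a) (p := A)
  have := congrArg (aeval C.x) hB
  rw [map_sub, aeval_C, map_mul, map_sub, aeval_X, aeval_C] at this
  rw [this, map_mul]
  exact mul_lt_one_of_lt_of_le h (Point.val_aeval_le_one h.val_x_le_one B)

theorem Point.val_eq_one_of_sub_lt_one (P : C.Point) {g : C.FunctionField} {c : k} (hc : c ≠ 0)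
    (h : P.val (g - algebraMap k C.FunctionField c) < 1) : P.val g = 1 := by
  have h1 := P.trivial_on_constants c hc
  rw [← h1]
  exact P.val.map_eq_of_sub_lt (by rwa [h1])

theorem Point.LiesOver.val_aeval_eq_one {P : C.Point} {a : k} (h : P.LiesOver a) {A : k[X]}
    (hA : A.eval a ≠ 0) : P.val (aeval C.x A) = 1 :=
  P.val_eq_one_of_sub_lt_one hA (h.val_aeval_sub_lt_one A)

theorem Point.LiesOver.val_aeval_lt_one_iff {P : C.Point} {a : k} (h : P.LiesOver a) {A : k[X]} :
    P.val (aeval C.x A) < 1 ↔ A.eval a = 0 := by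
  refine ⟨fun h1 => by_contra fun h2 => h1.ne (h.val_aeval_eq_one h2), fun h1 => ?_⟩
  simpa [h1] using h.val_aeval_sub_lt_one A

theorem Point.LiesOver.eq {P : C.Point} {a c : k} (h : P.LiesOver a) (h' : P.LiesOver c) :
    a = c := by
  have : P.val (aeval C.x (X - Polynomial.C c)) < 1 := by simpa [Point.LiesOver] using h'
  rw [h.val_aeval_lt_one_iff] at this
  simpa [sub_eq_zero] using this

theorem Point.IsAffine.b_sq {P : C.Point} {a b : k} (h : P.IsAffine a b) :
    b ^ 2 = C.f.eval a := by
  have ho : P.LiesOver a := h.1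
  have h1 := ho.val_aeval_sub_lt_one C.f
  have h2 : P.val ((C.y - algebraMap k C.FunctionField b) *
      (C.y + algebraMap k C.FunctionField b)) < 1 := by
    rw [map_mul]
    exact mul_lt_one_of_lt_of_le h.2
      (P.val.map_add_le (Point.val_y_le_one ho.val_x_le_one) (P.val_algebraMap_le_one b))
  have h3 := P.val.map_sub_lt h1 h2
  by_contra hne
  have h4 := P.trivial_on_constants _ (sub_ne_zero.2 hne)
  refine h3.ne ?_
  rw [← h4]
  congr 1
  rw [map_sub, map_pow, ← C.y_sq]
  ring

/-- With `b² = f(a)`, the function `f(x) - f(a) = (y - b)(y + b)` vanishes at `P`, so one factor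
does. -/
theorem Point.LiesOver.exists_isAffine [IsAlgClosed k] {P : C.Point} {a : k} (h : P.LiesOver a) :
    ∃ b, P.IsAffine a b := by
  obtain ⟨b, hb⟩ := IsAlgClosed.exists_pow_nat_eq (C.f.eval a) two_pos
  have h1 := h.val_aeval_sub_lt_one C.f
  have h2 : aeval C.x C.f - algebraMap k C.FunctionField (C.f.eval a) =
      (C.y - algebraMap k C.FunctionField b) * (C.y - algebraMap k C.FunctionField (-b)) := by
    rw [← C.y_sq, ← hb, map_pow, map_neg]
    ring
  rw [h2, map_mul] at h1
  by_contra! hcon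
  refine h1.not_ge (one_le_mul ?_ ?_)
  · exact not_lt.1 fun h' => hcon b ⟨h, h'⟩
  · exact not_lt.1 fun h' => hcon (-b) ⟨h, h'⟩

/-- Both `P` and `P'` send `g` to the same power of their value at `π`. -/
def CommonPow (P P' : C.Point) (π g : C.FunctionField) : Prop :=
  ∃ m : ℤ, P.val g = P.val π ^ m ∧ P'.val g = P'.val π ^ m

variable {P P' : C.Point} {π g h : C.FunctionField}

theorem CommonPow.of_eq_one (h : P.val g = 1) (h' : P'.val g = 1) : CommonPow P P' π g :=
  ⟨0, by simpa using h, by simpa using h'⟩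

theorem CommonPow.refl : CommonPow P P' π π := ⟨1, by simp, by simp⟩

theorem CommonPow.of_eq (h : P.val g = P.val π) (h' : P'.val g = P'.val π) : CommonPow P P' π g :=
  ⟨1, by simpa using h, by simpa using h'⟩

theorem CommonPow.mul (hπ : π ≠ 0) (hg : CommonPow P P' π g) (hh : CommonPow P P' π h) :
    CommonPow P P' π (g * h) := by
  obtain ⟨m, h1, h2⟩ := hg
  obtain ⟨l, h3, h4⟩ := hh
  refine ⟨m + l, ?_, ?_⟩
  · rw [map_mul, h1, h3, zpow_add₀ ((P.val.ne_zero_iff).2 hπ)]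
  · rw [map_mul, h2, h4, zpow_add₀ ((P'.val.ne_zero_iff).2 hπ)]

theorem CommonPow.inv (hg : CommonPow P P' π g) : CommonPow P P' π g⁻¹ := by
  obtain ⟨m, h1, h2⟩ := hg
  exact ⟨-m, by rw [map_inv₀, h1, zpow_neg], by rw [map_inv₀, h2, zpow_neg]⟩

theorem CommonPow.trans {ρ : C.FunctionField} (hg : CommonPow P P' π g)
    (hπ : CommonPow P P' ρ π) : CommonPow P P' ρ g := by
  obtain ⟨m, h1, h2⟩ := hg
  obtain ⟨l, h3, h4⟩ := hπ
  exact ⟨l * m, by rw [h1, h3, zpow_mul], by rw [h2, h4, zpow_mul]⟩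

theorem commonPow_of_ne_zero (hπ : π ≠ 0)
    (hpoly : ∀ D : k[X], D ≠ 0 → CommonPow P P' π (aeval C.x D))
    (hlin : ∀ A B : k[X], IsCoprime A B → CommonPow P P' π (aeval C.x A + aeval C.x B * C.y))
    (hh : h ≠ 0) : CommonPow P P' π h := by
  obtain ⟨A, B, D, G, hD, hG, hAB, he⟩ := C.exists_isCoprime_mul_aeval_eq hh
  rw [← eq_mul_inv_iff_mul_eq₀ (C.aeval_x_ne_zero.2 hD)] at he
  rw [he]
  exact ((hpoly G hG).mul hπ (hlin A B hAB)).mul hπ (hpoly D hD).inv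

theorem Point.ext_val (h : P.val = P'.val) : P = P' := by
  cases P
  cases P'
  cases h
  rfl

/-- Surjectivity of the valuation makes the value at `π` a generator of the value group. -/
theorem Point.val_uniformizer (hlt : P.val π < 1) (hπ : π ≠ 0)
    (H : ∀ h, h ≠ 0 → ∃ m : ℤ, P.val h = P.val π ^ m) : P.val π = WithZero.exp (-1) := by
  obtain ⟨h, hh⟩ := P.surjective (WithZero.exp (-1))
  obtain ⟨m, hm⟩ := H h ((P.val.ne_zero_iff).1 (by simp [hh]))
  have h0 : P.val π ≠ 0 := (P.val.ne_zero_iff).2 hπ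
  rw [← WithZero.exp_log h0] at hlt hm ⊢
  rw [hh, ← WithZero.exp_zsmul, WithZero.exp_inj, smul_eq_mul] at hm
  rw [← WithZero.exp_zero, WithZero.exp_lt_exp] at hlt
  rw [WithZero.exp_inj]
  have := Int.isUnit_iff.1 (IsUnit.of_mul_eq_one (b := -m) (a := (P.val π).log) (by linarith))
  omega

/-- Both valuations take the value `exp (-1)` at `π`, so equal exponents give equal valuations. This
yields uniqueness of a point and a local parameter in one stroke. -/
theorem Point.eq_and_val_uniformizer (hlt : P.val π < 1) (hlt' : P'.val π < 1) (hπ : π ≠ 0)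
    (H : ∀ h, h ≠ 0 → CommonPow P P' π h) : P = P' ∧ P.val π = WithZero.exp (-1) := by
  have h1 : P.val π = WithZero.exp (-1) :=
    Point.val_uniformizer hlt hπ fun h hh => (H h hh).imp fun _ => And.left
  have h2 : P'.val π = WithZero.exp (-1) :=
    Point.val_uniformizer hlt' hπ fun h hh => (H h hh).imp fun _ => And.right
  refine ⟨Point.ext_val (Valuation.ext fun h => ?_), h1⟩
  by_cases hh : h = 0
  · simp [hh]
  · obtain ⟨m, h3, h4⟩ := H h hh
    rw [h3, h4, h1, h2]

variable (C) in
theorem x_sub_ne_zero (a : k) : C.x - algebraMap k C.FunctionField a ≠ 0 := by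
  have := C.aeval_x_ne_zero.2 (X_sub_C_ne_zero a)
  simpa using this

variable (C) in
theorem y_ne_zero : C.y ≠ 0 := by
  intro h
  have := C.y_sq
  rw [h, zero_pow two_ne_zero, eq_comm] at this
  exact C.aeval_x_ne_zero.2 C.f_ne_zero this

theorem commonPow_aeval [IsAlgClosed k] {a : k} (hP : P.LiesOver a) (hP' : P'.LiesOver a)
    {D : k[X]} (hD : D ≠ 0) :
    CommonPow P P' (C.x - algebraMap k C.FunctionField a) (aeval C.x D) := by
  refine Polynomial.induction_of_isAlgClosed (M := fun D => CommonPow P P'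
    (C.x - algebraMap k C.FunctionField a) (aeval C.x D)) (fun c hc => ?_) (fun c => ?_)
    (fun A B hA hB => ?_) hD
  · rw [aeval_C]
    exact .of_eq_one (P.trivial_on_constants c hc) (P'.trivial_on_constants c hc)
  · by_cases hc : c = a
    · subst hc
      simpa using CommonPow.refl
    · have : (X - Polynomial.C c).eval a ≠ 0 := by simpa [sub_eq_zero] using Ne.symm hc
      exact .of_eq_one (hP.val_aeval_eq_one this) (hP'.val_aeval_eq_one this)
  · rw [map_mul]
    exact hA.mul (C.x_sub_ne_zero a) hB

theorem Point.IsAffine.val_add_mul_y_sub_lt_one {a b : k} (h : P.IsAffine a b) (A B : k[X]) :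
    P.val (aeval C.x A + aeval C.x B * C.y -
      algebraMap k C.FunctionField (A.eval a + B.eval a * b)) < 1 := by
  have ho : P.LiesOver a := h.1
  have e : aeval C.x A + aeval C.x B * C.y -
      algebraMap k C.FunctionField (A.eval a + B.eval a * b) =
      (aeval C.x A - algebraMap k C.FunctionField (A.eval a)) +
      ((aeval C.x B - algebraMap k C.FunctionField (B.eval a)) * C.y +
      algebraMap k C.FunctionField (B.eval a) * (C.y - algebraMap k C.FunctionField b)) := by
    rw [map_add, map_mul]
    ring
  rw [e]
  refine P.val.map_add_lt (ho.val_aeval_sub_lt_one A) (P.val.map_add_lt ?_ ?_)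
  · rw [map_mul]
    exact mul_lt_one_of_lt_of_le (ho.val_aeval_sub_lt_one B) (Point.val_y_le_one ho.val_x_le_one)
  · rw [map_mul, mul_comm]
    exact mul_lt_one_of_lt_of_le h.2 (P.val_algebraMap_le_one _)

theorem Point.IsAffine.val_add_mul_y_eq_one {a b : k} (h : P.IsAffine a b) {A B : k[X]}
    (hne : A.eval a + B.eval a * b ≠ 0) : P.val (aeval C.x A + aeval C.x B * C.y) = 1 :=
  P.val_eq_one_of_sub_lt_one hne (h.val_add_mul_y_sub_lt_one A B)

theorem eval_ne_zero_or_of_isCoprime {A B : k[X]} (hAB : IsCoprime A B) (a : k) :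
    A.eval a ≠ 0 ∨ B.eval a ≠ 0 := by
  obtain ⟨U, V, h⟩ := hAB
  by_contra! hc
  have := congrArg (eval a) h
  simp [hc] at this

/-- A point `(a, b)` with `b ≠ 0` is determined by its coordinates, and `x - a` is a local
parameter there. -/
theorem Point.IsAffine.eq_and_val_of_ne_zero [IsAlgClosed k] [CharZero k] {a b : k} (hb : b ≠ 0)
    (h : P.IsAffine a b) (h' : P'.IsAffine a b) :
    P = P' ∧ P.val (C.x - algebraMap k C.FunctionField a) = WithZero.exp (-1) := by
  have hpoly := fun (D : k[X]) (hD : D ≠ 0) => commonPow_aeval (P := P) (P' := P') h.1 h'.1 hD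
  refine Point.eq_and_val_uniformizer h.1 h'.1 (C.x_sub_ne_zero a) fun g hg =>
    commonPow_of_ne_zero (C.x_sub_ne_zero a) hpoly (fun A B hAB => ?_) hg
  by_cases hc : A.eval a + B.eval a * b = 0
  -- If `A + B y` vanishes at `(a, b)`, coprimality and `b ≠ 0` make the conjugate `A - B y` a unit
  -- there, so `A + B y` has the value of its norm, a polynomial in `x`.
  · have hc' : A.eval a + (-B).eval a * b ≠ 0 := by
      intro hc'
      rw [eval_neg] at hc'
      have hA : A.eval a = 0 := by linear_combination (hc + hc') / 2
      have hB : B.eval a * b = 0 := by linear_combination (hc - hc') / 2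
      rcases eval_ne_zero_or_of_isCoprime hAB a with h1 | h1
      · exact h1 hA
      · exact mul_ne_zero h1 hb hB
    have e1 := h.val_add_mul_y_eq_one hc'
    have e2 := h'.val_add_mul_y_eq_one hc'
    rw [map_neg, neg_mul, ← sub_eq_add_neg] at e1 e2
    have hu : aeval C.x A - aeval C.x B * C.y ≠ 0 := by
      rw [← P.val.ne_zero_iff, e1]
      exact one_ne_zero
    have hw : aeval C.x A + aeval C.x B * C.y ≠ 0 := by
      intro hw
      apply hu
      have := congrArg C.conj hw
      simpa [← sub_eq_add_neg] using this
    have hn : A ^ 2 - C.f * B ^ 2 ≠ 0 := by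
      rw [← C.aeval_x_ne_zero, ← C.norm_eq]
      exact mul_ne_zero hw hu
    have key := (hpoly _ hn).mul (C.x_sub_ne_zero a) (CommonPow.of_eq_one e1 e2).inv
    rwa [← C.norm_eq, mul_assoc, mul_inv_cancel₀ hu, mul_one] at key
  · exact .of_eq_one (h.val_add_mul_y_eq_one hc) (h'.val_add_mul_y_eq_one hc)

/-- Since `f` is squarefree, `a` is a simple root, so `y²` is `x - a` times a unit at `P`. -/
theorem Point.IsAffine.val_y_sq_of_zero {a : k} (h : P.IsAffine a 0) :
    P.val C.y ^ 2 = P.val (C.x - algebraMap k C.FunctionField a) := by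
  have hf := h.b_sq
  rw [zero_pow two_ne_zero, eq_comm] at hf
  obtain ⟨g, hg⟩ := dvd_iff_isRoot.2 hf
  have hga : g.eval a ≠ 0 := by
    intro h0
    obtain ⟨g', rfl⟩ := dvd_iff_isRoot.2 h0
    refine not_isUnit_X_sub_C a (C.squarefree_f _ ⟨g', by rw [hg, mul_assoc]⟩)
  rw [← map_pow, C.y_sq, hg, map_mul, map_mul, Point.LiesOver.val_aeval_eq_one h.1 hga, mul_one]
  simp

theorem Point.IsAffine.val_y_lt_one_of_zero {a : k} (h : P.IsAffine a 0) : P.val C.y < 1 := by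
  simpa using h.2

/-- A point `(a, 0)` is determined by its coordinates, and `y` is a local parameter there. -/
theorem Point.IsAffine.eq_and_val_of_zero [IsAlgClosed k] {a : k}
    (h : P.IsAffine a 0) (h' : P'.IsAffine a 0) :
    P = P' ∧ P.val C.y = WithZero.exp (-1) := by
  have hx : CommonPow P P' C.y (C.x - algebraMap k C.FunctionField a) :=
    ⟨2, by rw [← h.val_y_sq_of_zero]; norm_cast, by rw [← h'.val_y_sq_of_zero]; norm_cast⟩
  have hpoly := fun (D : k[X]) (hD : D ≠ 0) =>
    (commonPow_aeval (P := P) (P' := P') h.1 h'.1 hD).trans hx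
  refine Point.eq_and_val_uniformizer h.val_y_lt_one_of_zero h'.val_y_lt_one_of_zero C.y_ne_zero
    fun g hg => commonPow_of_ne_zero C.y_ne_zero hpoly (fun A B hAB => ?_) hg
  -- If `A(a) = 0`, then `B(a) ≠ 0` and `A` vanishes to at least the order of `y²`, so `B y`
  -- dominates.
  by_cases hA : A.eval a = 0
  · have hB := (eval_ne_zero_or_of_isCoprime hAB a).resolve_left (not_not_intro hA)
    have key : ∀ Q : C.Point, Q.IsAffine a 0 →
        Q.val (aeval C.x A + aeval C.x B * C.y) = Q.val C.y := by
      intro Q hQ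
      have hQo : Q.LiesOver a := hQ.1
      have h1 : Q.val (aeval C.x B * C.y) = Q.val C.y := by
        rw [map_mul, hQo.val_aeval_eq_one hB, one_mul]
      rw [← h1]
      apply Q.val.map_add_eq_of_lt_right
      rw [h1]
      obtain ⟨A', rfl⟩ := dvd_iff_isRoot.2 hA
      have h2 : Q.val (aeval C.x (X - Polynomial.C a)) = Q.val C.y ^ 2 := by
        rw [hQ.val_y_sq_of_zero]; simp
      rw [map_mul, map_mul, h2]
      have hy0 : 0 < Q.val C.y := Q.val.pos_iff.2 C.y_ne_zero
      calc Q.val C.y ^ 2 * Q.val (aeval C.x A') ≤ Q.val C.y ^ 2 * 1 :=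
            mul_le_mul_right (Point.val_aeval_le_one hQo.val_x_le_one A') _
        _ = Q.val C.y * Q.val C.y := by rw [mul_one, pow_two]
        _ < Q.val C.y := mul_lt_of_lt_one_right hy0 hQ.val_y_lt_one_of_zero
    exact .of_eq (key P h) (key P' h')
  · exact .of_eq_one (h.val_add_mul_y_eq_one (by simpa using hA))
      (h'.val_add_mul_y_eq_one (by simpa using hA))

theorem Point.IsInfinity.val_aeval (h : P.IsInfinity) {A : k[X]} (hA : A ≠ 0) :
    P.val (aeval C.x A) = P.val C.x ^ A.natDegree :=
  valuation_aeval_eq_valuation_X_pow_natDegree_of_one_lt_valuation_X _ h hA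

theorem Point.IsInfinity.val_y_sq (h : P.IsInfinity) :
    P.val C.y ^ 2 = P.val C.x ^ (2 * γ + 1) := by
  rw [← map_pow, C.y_sq, h.val_aeval C.f_ne_zero, C.natDegree_f]

/-- At infinity the even part and the odd part of a function have different orders. -/
theorem Point.IsInfinity.val_lt_iff (h : P.IsInfinity) {A B : k[X]} (hA : A ≠ 0) (hB : B ≠ 0) :
    P.val (aeval C.x A) < P.val (aeval C.x B * C.y) ↔
      2 * A.natDegree < 2 * B.natDegree + 2 * γ + 1 := by
  rw [← pow_lt_pow_iff_left₀ zero_le zero_le two_ne_zero, map_mul, mul_pow, h.val_y_sq,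
    h.val_aeval hA, h.val_aeval hB, ← pow_mul, ← pow_mul, ← pow_add, pow_lt_pow_iff_right₀ h]
  omega

theorem Point.IsInfinity.val_lt_iff' (h : P.IsInfinity) {A B : k[X]} (hA : A ≠ 0) (hB : B ≠ 0) :
    P.val (aeval C.x B * C.y) < P.val (aeval C.x A) ↔
      2 * B.natDegree + 2 * γ + 1 < 2 * A.natDegree := by
  rw [← pow_lt_pow_iff_left₀ zero_le zero_le two_ne_zero, map_mul, mul_pow, h.val_y_sq,
    h.val_aeval hA, h.val_aeval hB, ← pow_mul, ← pow_mul, ← pow_add, pow_lt_pow_iff_right₀ h]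
  omega

theorem Point.IsInfinity.val_add_mul_y (h : P.IsInfinity) (A B : k[X]) :
    P.val (aeval C.x A + aeval C.x B * C.y) =
      max (P.val (aeval C.x A)) (P.val (aeval C.x B * C.y)) := by
  by_cases hA : A = 0
  · simp [hA]
  by_cases hB : B = 0
  · simp [hB]
  refine P.val.map_add_of_distinct_val fun he => ?_
  have h1 := (h.val_lt_iff hA hB).not.1 he.not_lt
  have h2 := (h.val_lt_iff' hA hB).not.1 he.not_gt
  omega

/-- The point at infinity is unique; `x` and `y` have poles of order `2` and `2γ + 1` there. -/
theorem Point.IsInfinity.eq_and_val (h : P.IsInfinity) (h' : P'.IsInfinity) :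
    P = P' ∧ P.val C.x = WithZero.exp 2 ∧ P.val C.y = WithZero.exp (2 * γ + 1 : ℤ) := by
  -- As `y²` has the same value as `x ^ (2γ + 1)`, this `π` satisfies `π² ~ 1 / x`.
  set π : C.FunctionField := C.x ^ γ * C.y⁻¹ with hπdef
  have hx0 : C.x ≠ 0 := by simpa using C.x_sub_ne_zero 0
  have hπ : π ≠ 0 := mul_ne_zero (pow_ne_zero _ hx0) (inv_ne_zero C.y_ne_zero)
  have key : ∀ Q : C.Point, Q.IsInfinity → Q.val π ^ 2 = (Q.val C.x)⁻¹ := by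
    intro Q hQ
    have hQx : Q.val C.x ≠ 0 := Q.val.ne_zero_iff.2 hx0
    rw [hπdef, map_mul, map_inv₀, mul_pow, inv_pow, hQ.val_y_sq, map_pow, ← pow_mul, pow_succ,
      mul_comm 2 γ, mul_inv, ← mul_assoc, mul_inv_cancel₀ (pow_ne_zero _ hQx), one_mul]
  have hlt : ∀ Q : C.Point, Q.IsInfinity → Q.val π < 1 := by
    intro Q hQ
    rw [← pow_lt_one_iff_of_nonneg zero_le two_ne_zero, key Q hQ]
    exact inv_lt_one_of_one_lt₀ hQ
  have hx : CommonPow P P' π C.x := by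
    refine ⟨-2, ?_, ?_⟩
    · rw [zpow_neg, eq_comm, inv_eq_iff_eq_inv, ← key P h]; norm_cast
    · rw [zpow_neg, eq_comm, inv_eq_iff_eq_inv, ← key P' h']; norm_cast
  have hxpow : ∀ n : ℕ, CommonPow P P' C.x (C.x ^ n) := fun n => ⟨n, by simp, by simp⟩
  have hy : CommonPow P P' π C.y := by
    have := ((hxpow γ).trans hx).mul hπ (CommonPow.refl (P := P) (P' := P') (π := π)).inv
    rwa [hπdef, mul_inv, inv_inv, ← mul_assoc, mul_inv_cancel₀ (pow_ne_zero _ hx0), one_mul] at this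
  have hpoly : ∀ D : k[X], D ≠ 0 → CommonPow P P' π (aeval C.x D) := fun D hD =>
    CommonPow.trans ⟨D.natDegree, by rw [h.val_aeval hD, zpow_natCast],
      by rw [h'.val_aeval hD, zpow_natCast]⟩ hx
  have hmain := Point.eq_and_val_uniformizer (hlt P h) (hlt P' h') hπ fun g hg =>
    commonPow_of_ne_zero hπ hpoly (fun A B hAB => ?_) hg
  · have hxv : P.val C.x = WithZero.exp 2 := by
      have := key P h
      rw [hmain.2, ← WithZero.exp_nsmul, eq_comm, inv_eq_iff_eq_inv, ← WithZero.exp_neg] at this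
      simpa using this
    refine ⟨hmain.1, hxv, ?_⟩
    have hπ2 := hmain.2
    rw [hπdef, map_mul, map_inv₀, map_pow, hxv, mul_inv_eq_iff_eq_mul₀
      (P.val.ne_zero_iff.2 C.y_ne_zero), ← inv_mul_eq_iff_eq_mul₀ (by simp)] at hπ2
    rw [← hπ2, ← WithZero.exp_nsmul, ← WithZero.exp_neg, ← WithZero.exp_add]
    congr 1
    simp
    ring
  · by_cases hA : A = 0
    · have hB : B ≠ 0 := by rintro rfl; simp [hA, not_isCoprime_zero_zero] at hAB
      rw [hA, map_zero, zero_add]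
      exact (hpoly B hB).mul hπ hy
    by_cases hB : B = 0
    · rw [hB, map_zero, zero_mul, add_zero]
      exact hpoly A hA
    by_cases hc : 2 * A.natDegree < 2 * B.natDegree + 2 * γ + 1
    · obtain ⟨m, h1, h2⟩ := (hpoly B hB).mul hπ hy
      exact ⟨m, by rw [P.val.map_add_eq_of_lt_right ((h.val_lt_iff hA hB).2 hc), h1],
        by rw [P'.val.map_add_eq_of_lt_right ((h'.val_lt_iff hA hB).2 hc), h2]⟩
    · have hc' : 2 * B.natDegree + 2 * γ + 1 < 2 * A.natDegree := by omega
      obtain ⟨m, h1, h2⟩ := hpoly A hA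
      exact ⟨m, by rw [P.val.map_add_eq_of_lt_left ((h.val_lt_iff' hA hB).2 hc'), h1],
        by rw [P'.val.map_add_eq_of_lt_left ((h'.val_lt_iff' hA hB).2 hc'), h2]⟩

end Points

end OddHyperellipticCurve

namespace OddHyperellipticCurve

/-! ### Divisors of functions and the theta strata. -/

section Divisors

variable {k : Type*} [Field k] {γ : ℕ} {C : OddHyperellipticCurve k γ} {P Q q : C.Point}
  {g h : C.FunctionField}

/-- The hyperelliptic involution on points. -/
noncomputable def Point.conj (P : C.Point) : C.Point where
  val := P.val.comap (C.conj : C.FunctionField →+* C.FunctionField)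
  surjective z := by
    obtain ⟨g, hg⟩ := P.surjective z
    exact ⟨C.conj g, by simpa [Valuation.comap_apply] using hg⟩
  trivial_on_constants c hc := by
    simpa [Valuation.comap_apply] using P.trivial_on_constants c hc

theorem Point.conj_val (P : C.Point) (g : C.FunctionField) : P.conj.val g = P.val (C.conj g) := rfl

@[simp] theorem Point.conj_conj (P : C.Point) : P.conj.conj = P :=
  Point.ext_val (Valuation.ext fun g => by simp [Point.conj_val])

theorem Point.conj_injective : Function.Injective (Point.conj : C.Point → C.Point) :=
  Function.LeftInverse.injective Point.conj_conj

theorem Point.IsAffine.conj {a b : k} (h : P.IsAffine a b) : P.conj.IsAffine a (-b) := by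
  refine ⟨by simpa [Point.conj_val] using h.1, ?_⟩
  have e : -C.y - algebraMap k C.FunctionField (-b) =
      -(C.y - algebraMap k C.FunctionField b) := by
    rw [map_neg]
    ring
  rw [Point.conj_val, map_sub, conj_y, conj_algebraMap, e, Valuation.map_neg]
  exact h.2

theorem Point.IsAffine.eq_snd {a b b' : k} (h : P.IsAffine a b) (h' : P.IsAffine a b') :
    b = b' := by
  by_contra hne
  have h1 := P.val.map_sub_lt h'.2 h.2
  rw [sub_sub_sub_cancel_left, ← map_sub, P.trivial_on_constants _ (sub_ne_zero.2 hne)] at h1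
  exact lt_irrefl _ h1

/-- Otherwise all nonzero polynomials in `x` have value one, so every function has value at most
one, against surjectivity. -/
theorem Point.exists_liesOver [IsAlgClosed k] (hx : P.val C.x ≤ 1) : ∃ a, P.LiesOver a := by
  by_contra! hcon
  have hpoly : ∀ A : k[X], A ≠ 0 → P.val (aeval C.x A) = 1 := by
    intro A hA
    refine Polynomial.induction_of_isAlgClosed (M := fun A => P.val (aeval C.x A) = 1)
      (fun c hc => ?_) (fun c => ?_) (fun A B hA hB => ?_) hA
    · rw [aeval_C]
      exact P.trivial_on_constants c hc
    · refine le_antisymm (Point.val_aeval_le_one hx _) ?_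
      simpa using not_lt.1 (hcon c)
    · rw [map_mul, map_mul, hA, hB, one_mul]
  have hlin : ∀ A B : k[X], P.val (aeval C.x A + aeval C.x B * C.y) ≤ 1 := fun A B =>
    P.val.map_add_le (Point.val_aeval_le_one hx A) (by
      rw [map_mul]
      exact mul_le_one' (Point.val_aeval_le_one hx B) (Point.val_y_le_one hx))
  have hle : ∀ g : C.FunctionField, P.val g ≤ 1 := by
    intro g
    obtain ⟨A, B, D, hD, he⟩ := C.exists_mul_aeval_eq g
    have := hlin A B
    rwa [← he, map_mul, hpoly D hD, mul_one] at this
  obtain ⟨g, hg⟩ := P.surjective (WithZero.exp 1)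
  have := hle g
  rw [hg, ← WithZero.exp_zero, WithZero.exp_le_exp] at this
  omega

theorem Point.IsInfinity.not_isAffine {a b : k} (h : P.IsInfinity) : ¬P.IsAffine a b := fun h' =>
  (show P.LiesOver a from h'.1).val_x_le_one.not_gt h

theorem Point.ord_mul (P : C.Point) (hg : g ≠ 0) (hh : h ≠ 0) :
    P.ord (g * h) = P.ord g + P.ord h := by
  rw [Point.ord, map_mul, WithZero.log_mul (P.val.ne_zero_iff.2 hg) (P.val.ne_zero_iff.2 hh)]
  simp only [Point.ord]
  ring

theorem Point.ord_of_val_eq_exp {m : ℤ} (hg : P.val g = WithZero.exp m) : P.ord g = -m := by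
  rw [Point.ord, hg, WithZero.log_exp]

theorem Point.ord_of_val_eq_one (hg : P.val g = 1) : P.ord g = 0 := by
  rw [Point.ord, hg, WithZero.log_one, neg_zero]

theorem Point.le_ord_iff {m : ℤ} (hg : g ≠ 0) : m ≤ P.ord g ↔ P.val g ≤ WithZero.exp (-m) := by
  rw [← WithZero.log_le_iff_le_exp (P.val.ne_zero_iff.2 hg), Point.ord]
  omega

theorem Point.ord_conj (P : C.Point) (g : C.FunctionField) : P.conj.ord g = P.ord (C.conj g) := rfl

/-- `D` is the divisor of the function `g`. -/
def IsDivisorOf (D : C.Point →₀ ℤ) (g : C.FunctionField) : Prop := ∀ P : C.Point, D P = P.ord g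

theorem degree_single (P : C.Point) (m : ℤ) : C.degree (Finsupp.single P m) = m := by
  simp [degree]

/-- The fibre of `x` over `a` is `P + ι P`, and the divisor of poles of `x` is `2 q`. -/
theorem isDivisorOf_x_sub [IsAlgClosed k] [CharZero k] {a : k} (hq : q.IsInfinity)
    (hP : P.LiesOver a) :
    IsDivisorOf (Finsupp.single P 1 + Finsupp.single P.conj 1 - Finsupp.single q 2)
      (C.x - algebraMap k C.FunctionField a) := by
  classical
  intro Q
  obtain ⟨b, hb⟩ := hP.exists_isAffine
  have hb' := hb.conj
  have hPq : P ≠ q := fun h => hq.not_isAffine (h ▸ hb)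
  have hPq' : P.conj ≠ q := fun h => hq.not_isAffine (h ▸ hb')
  simp only [Finsupp.coe_sub, Finsupp.coe_add, Pi.sub_apply, Pi.add_apply, Finsupp.single_apply]
  by_cases hQ : Q.IsInfinity
  · obtain ⟨rfl, hx, -⟩ := hQ.eq_and_val hq
    have : Q.val (C.x - algebraMap k C.FunctionField a) = WithZero.exp 2 := by
      rw [← hx]
      exact Q.val.map_sub_eq_of_lt_left ((Q.val_algebraMap_le_one a).trans_lt hQ)
    rw [Point.ord_of_val_eq_exp this, if_neg hPq, if_neg hPq', if_pos rfl]
    norm_num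
  have hqQ : q ≠ Q := by
    rintro rfl
    exact hQ hq
  obtain ⟨a', ha'⟩ := Point.exists_liesOver (not_lt.1 hQ)
  rw [if_neg hqQ]
  by_cases haa : a' = a
  · subst haa
    obtain ⟨c, hc⟩ := ha'.exists_isAffine
    -- At a branch point `P = ιP` and `x - a` has a double zero; otherwise `P` and `ιP` are distinct
    -- simple zeros.
    by_cases hb0 : b = 0
    · subst hb0
      rw [neg_zero] at hb'
      have hc0 : c = 0 := by
        have := hc.b_sq
        rw [← hb.b_sq] at this
        simpa using this
      subst hc0
      have e1 := (hc.eq_and_val_of_zero hb).1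
      have e2 := (hc.eq_and_val_of_zero hb').1
      rw [if_pos e1.symm, if_pos e2.symm, Point.ord_of_val_eq_exp (m := -2)]
      · norm_num
      · rw [← hc.val_y_sq_of_zero, (hc.eq_and_val_of_zero hb).2, ← WithZero.exp_nsmul]
        rfl
    · have hbne : b ≠ -b := fun h => hb0 (self_eq_neg.1 h)
      have hcb : c = b ∨ c = -b := by
        rw [← sq_eq_sq_iff_eq_or_eq_neg, hc.b_sq, hb.b_sq]
      rcases hcb with rfl | rfl
      · obtain ⟨rfl, hv⟩ := hc.eq_and_val_of_ne_zero hb0 hb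
        rw [Point.ord_of_val_eq_exp hv, if_pos rfl, if_neg]
        · norm_num
        · intro he
          rw [he] at hb'
          exact hbne (hc.eq_snd hb')
      · obtain ⟨rfl, hv⟩ := hc.eq_and_val_of_ne_zero (neg_ne_zero.2 hb0) hb'
        rw [Point.ord_of_val_eq_exp hv, if_neg, if_pos rfl]
        · norm_num
        · intro he
          rw [← he] at hb'
          exact hbne (hb.eq_snd hb')
  · have hne : (X - Polynomial.C a).eval a' ≠ 0 := by simpa [sub_eq_zero] using haa
    have hv := ha'.val_aeval_eq_one hne
    rw [map_sub, aeval_X, aeval_C] at hv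
    rw [Point.ord_of_val_eq_one hv, if_neg, if_neg]
    · norm_num
    · rintro rfl
      exact haa (ha'.eq hb'.1)
    · rintro rfl
      exact haa (ha'.eq hP)

theorem exists_isDivisorOf_aeval [IsAlgClosed k] [CharZero k] (hq : q.IsInfinity) {A : k[X]}
    (hA : A ≠ 0) :
    ∃ D : C.Point →₀ ℤ, IsDivisorOf D (aeval C.x A) ∧ C.degree D = 0 := by
  suffices H : aeval C.x A ≠ 0 ∧
      ∃ D : C.Point →₀ ℤ, IsDivisorOf D (aeval C.x A) ∧ C.degree D = 0 from H.2
  refine Polynomial.induction_of_isAlgClosed (M := fun A => aeval C.x A ≠ 0 ∧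
      ∃ D : C.Point →₀ ℤ, IsDivisorOf D (aeval C.x A) ∧ C.degree D = 0)
      (fun c hc => ⟨C.aeval_x_ne_zero.2 (C_ne_zero.2 hc), 0, fun P => ?_, map_zero _⟩)
      (fun c => ⟨C.aeval_x_ne_zero.2 (X_sub_C_ne_zero c), ?_⟩) (fun A B hA hB => ?_) hA
  · rw [aeval_C, Point.ord_of_val_eq_one (P.trivial_on_constants c hc), Finsupp.coe_zero,
      Pi.zero_apply]
  · obtain ⟨P, hP⟩ := C.exists_point_over c
    refine ⟨Finsupp.single P 1 + Finsupp.single P.conj 1 - Finsupp.single q 2, ?_, ?_⟩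
    · rw [map_sub, aeval_X, aeval_C]
      exact isDivisorOf_x_sub hq hP
    · rw [map_sub, map_add, degree_single, degree_single, degree_single]
      norm_num
  · obtain ⟨hA0, D, hD, hD0⟩ := hA
    obtain ⟨hB0, E, hE, hE0⟩ := hB
    rw [map_mul]
    refine ⟨mul_ne_zero hA0 hB0, D + E, fun P => ?_, by rw [map_add, hD0, hE0, add_zero]⟩
    rw [P.ord_mul hA0 hB0, Finsupp.add_apply, hD, hE]

theorem degree_mapDomain_conj (D : C.Point →₀ ℤ) :
    C.degree (D.mapDomain Point.conj) = C.degree D := by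
  induction D using Finsupp.induction_linear with
  | zero => simp
  | add D E hD hE => rw [Finsupp.mapDomain_add, map_add, map_add, hD, hE]
  | single P m => rw [Finsupp.mapDomain_single, degree_single, degree_single]

theorem Point.val_add_mul_y_le_one (hx : P.val C.x ≤ 1) (A B : k[X]) :
    P.val (aeval C.x A + aeval C.x B * C.y) ≤ 1 :=
  P.val.map_add_le (Point.val_aeval_le_one hx A) (by
    rw [map_mul]
    exact mul_le_one' (Point.val_aeval_le_one hx B) (Point.val_y_le_one hx))

/-- The divisor of a function that is regular at the finite points has degree zero. -/
theorem exists_isDivisorOf_add_mul_y [IsAlgClosed k] [CharZero k] (hq : q.IsInfinity) {A B : k[X]}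
    (hAB : aeval C.x A + aeval C.x B * C.y ≠ 0) :
    ∃ D : C.Point →₀ ℤ, IsDivisorOf D (aeval C.x A + aeval C.x B * C.y) ∧ C.degree D = 0 := by
  classical
  set g := aeval C.x A + aeval C.x B * C.y with hg
  have hconj : C.conj g = aeval C.x A - aeval C.x B * C.y := by
    simp [hg, sub_eq_add_neg]
  have hconj0 : C.conj g ≠ 0 := (map_ne_zero_iff _ C.conj.toRingHom.injective).2 hAB
  -- `g` and its conjugate are both regular at finite points, so the zeros of `g` there are among
  -- those of the norm, a polynomial in `x`. Comparing divisors then gives `2 deg D = 0`.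
  have hN : g * C.conj g = aeval C.x (A ^ 2 - C.f * B ^ 2) := by rw [hconj, hg, norm_eq]
  obtain ⟨N, hND, hN0⟩ := exists_isDivisorOf_aeval hq
    (C.aeval_x_ne_zero.1 (hN ▸ mul_ne_zero hAB hconj0))
  have hsum : ∀ P : C.Point, P.ord g + P.ord (C.conj g) = N P := fun P => by
    rw [hND, ← hN, P.ord_mul hAB hconj0]
  have hfin : (Function.support fun P : C.Point => P.ord g).Finite := by
    refine (insert q N.support).finite_toSet.subset fun P hP => ?_
    by_contra hcon
    rw [Finset.mem_coe, Finset.mem_insert, not_or, Finsupp.notMem_support_iff] at hcon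
    have hx : P.val C.x ≤ 1 := not_lt.1 fun hx =>
      hcon.1 (Point.IsInfinity.eq_and_val (show P.IsInfinity from hx) hq).1
    have h1 : 0 ≤ P.ord g := by
      rw [Point.le_ord_iff hAB]
      simpa using Point.val_add_mul_y_le_one hx A B
    have h2 : 0 ≤ P.ord (C.conj g) := by
      rw [Point.le_ord_iff hconj0, hconj]
      simpa [sub_eq_add_neg] using Point.val_add_mul_y_le_one hx A (-B)
    have h3 := hsum P
    have h4 : P.ord g ≠ 0 := hP
    omega
  refine ⟨Finsupp.ofSupportFinite _ hfin, fun P => rfl, ?_⟩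
  set D := Finsupp.ofSupportFinite _ hfin with hD
  have hDN : D + D.mapDomain Point.conj = N := by
    ext P
    rw [Finsupp.add_apply, ← hsum P]
    congr 1
    have := Finsupp.mapDomain_apply Point.conj_injective D P.conj
    rw [Point.conj_conj] at this
    rw [this]
    exact P.ord_conj g
  have := congrArg C.degree hDN
  rw [map_add, degree_mapDomain_conj, hN0] at this
  omega

theorem exists_eq_sum_single {d : ℕ} {E : C.Point →₀ ℤ} (hE : ∀ P, 0 ≤ E P)
    (hd : C.degree E = d) : ∃ P : Fin d → C.Point, E = ∑ i, Finsupp.single (P i) 1 := by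
  classical
  have hsum : C.degree E = ∑ P ∈ E.support, E P := by
    rw [degree, Finsupp.liftAddHom_apply]
    rfl
  induction d generalizing E with
  | zero =>
    refine ⟨Fin.elim0, ?_⟩
    rw [hd, Nat.cast_zero, eq_comm, Finset.sum_eq_zero_iff_of_nonneg fun P _ => hE P] at hsum
    ext P
    by_cases hP : P ∈ E.support
    · simpa using hsum P hP
    · simpa using hP
  | succ d ih =>
    have hne : ∃ P, E P ≠ 0 := by
      by_contra! hcon
      have : E = 0 := Finsupp.ext hcon
      rw [this, map_zero] at hd
      omega
    obtain ⟨P, hP⟩ := hne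
    obtain ⟨R, hR⟩ := ih (E := E - Finsupp.single P 1) (fun Q => by
      have h1 := hE Q
      rw [Finsupp.sub_apply, Finsupp.single_apply]
      split_ifs with h
      · subst h
        omega
      · omega) (by rw [map_sub, degree_single, hd]; push_cast; ring) (by
        rw [degree, Finsupp.liftAddHom_apply]
        rfl)
    refine ⟨Fin.cons P R, ?_⟩
    rw [Fin.sum_univ_succ]
    simp only [Fin.cons_zero, Fin.cons_succ]
    rw [← hR]
    abel

/-- The class of `D - (deg D) q` in the Jacobian. -/
noncomputable def divisorClass (q : C.Point) : (C.Point →₀ ℤ) →+ C.Jac :=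
  (QuotientAddGroup.mk' C.principal).comp
    ((AddMonoidHom.id _ - (Finsupp.singleAddHom q).comp C.degree).codRestrict C.degree.ker
      fun D => by simp [AddMonoidHom.mem_ker, degree_single])

theorem divisorClass_single (q P : C.Point) :
    divisorClass q (Finsupp.single P 1) = pointClass P q := by
  simp only [divisorClass, pointClass, AddMonoidHom.comp_apply, QuotientAddGroup.mk'_apply]
  congr 1
  ext1
  simp [degree_single]

theorem divisorClass_eq_zero_iff {D : C.Point →₀ ℤ} :
    divisorClass q D = 0 ↔
      ∃ g : C.FunctionField, g ≠ 0 ∧ IsDivisorOf (D - Finsupp.single q (C.degree D)) g := by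
  simp only [divisorClass, AddMonoidHom.comp_apply, QuotientAddGroup.mk'_apply]
  rw [QuotientAddGroup.eq_zero_iff]
  rfl

theorem divisorClass_conj [IsAlgClosed k] [CharZero k] (hq : q.IsInfinity) (P : C.Point) :
    ∃ P' : C.Point,
      divisorClass q (Finsupp.single P' 1) = -divisorClass q (Finsupp.single P 1) := by
  by_cases hP : P.IsInfinity
  · refine ⟨P, ?_⟩
    rw [(hP.eq_and_val hq).1, divisorClass_single, pointClass_self, neg_zero]
  · obtain ⟨a, ha⟩ := Point.exists_liesOver (not_lt.1 hP)
    refine ⟨P.conj, ?_⟩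
    rw [eq_neg_iff_add_eq_zero, ← map_add, divisorClass_eq_zero_iff]
    refine ⟨_, C.x_sub_ne_zero a, ?_⟩
    rw [map_add, degree_single, degree_single, add_comm (Finsupp.single P.conj 1)]
    exact isDivisorOf_x_sub hq ha

/-- Negating the class of each `P i` by the involution turns an equality of classes into the
principality of one divisor. -/
theorem nsmul_mem_theta_iff_exists_divisor [IsAlgClosed k] [CharZero k] (hq : q.IsInfinity)
    (p : C.Point) (n d : ℕ) :
    n • pointClass p q ∈ theta q d ↔ ∃ P : Fin d → C.Point, ∃ g : C.FunctionField, g ≠ 0 ∧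
      IsDivisorOf (Finsupp.single p (n : ℤ) + ∑ i, Finsupp.single (P i) 1 -
        Finsupp.single q (n + d : ℤ)) g := by
  have key : ∀ P : Fin d → C.Point,
      (n • pointClass p q + ∑ i, pointClass (P i) q = 0 ↔ ∃ g : C.FunctionField, g ≠ 0 ∧
        IsDivisorOf (Finsupp.single p (n : ℤ) + ∑ i, Finsupp.single (P i) 1 -
          Finsupp.single q (n + d : ℤ)) g) := by
    intro P
    have e : n • pointClass p q + ∑ i, pointClass (P i) q =
        divisorClass q (Finsupp.single p (n : ℤ) + ∑ i, Finsupp.single (P i) 1) := by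
      rw [map_add, map_sum, ← divisorClass_single, ← map_nsmul, Finsupp.smul_single]
      simp [divisorClass_single]
    rw [e, divisorClass_eq_zero_iff]
    simp [degree_single]
  choose σ hσ using divisorClass_conj (C := C) hq
  simp only [divisorClass_single] at hσ
  constructor
  · rintro ⟨P, hP⟩
    refine ⟨fun i => σ (P i), (key _).1 ?_⟩
    rw [← hP]
    simp [hσ]
  · rintro ⟨P, hP⟩
    refine ⟨fun i => σ (P i), ?_⟩
    have := (key P).2 hP
    simp only [hσ, Finset.sum_neg_distrib]
    rw [eq_comm, ← add_eq_zero_iff_eq_neg]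
    exact this

/-- Membership in the theta strata in terms of functions `A + B y`. -/
theorem nsmul_mem_theta_iff_exists_function [IsAlgClosed k] [CharZero k] (hq : q.IsInfinity)
    {p : C.Point} (hpq : p ≠ q) (n d : ℕ) :
    n • pointClass p q ∈ theta q d ↔ ∃ A B : k[X], aeval C.x A + aeval C.x B * C.y ≠ 0 ∧
      q.val (aeval C.x A + aeval C.x B * C.y) ≤ WithZero.exp (n + d : ℤ) ∧
      p.val (aeval C.x A + aeval C.x B * C.y) ≤ WithZero.exp (-(n : ℤ)) := by
  classical
  rw [nsmul_mem_theta_iff_exists_divisor hq]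
  constructor
  · rintro ⟨P, g, hg, hD⟩
    have hs : ∀ Q, 0 ≤ (∑ i, Finsupp.single (P i) (1 : ℤ)) Q := fun Q => by
      rw [Finsupp.finsetSum_apply]
      refine Finset.sum_nonneg fun i _ => ?_
      rw [Finsupp.single_apply]
      split_ifs <;> norm_num
    have hD' : ∀ Q : C.Point, (if p = Q then (n : ℤ) else 0) +
        (∑ i, Finsupp.single (P i) (1 : ℤ)) Q - (if q = Q then (n + d : ℤ) else 0) = Q.ord g :=
      fun Q => by
        rw [← hD Q, Finsupp.sub_apply, Finsupp.add_apply, Finsupp.single_apply,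
          Finsupp.single_apply]
    obtain ⟨A, B, rfl⟩ := C.exists_eq_of_forall_point (h := g) fun Q hQ => by
      have hqQ : q ≠ Q := by
        rintro rfl
        exact hQ.not_gt hq
      have h1 := hD' Q
      have h2 := hs Q
      rw [if_neg hqQ] at h1
      have h3 : (0 : ℤ) ≤ Q.ord g := by
        rw [← h1]
        split_ifs <;> omega
      rw [Point.le_ord_iff hg] at h3
      simpa using h3
    refine ⟨A, B, hg, ?_, ?_⟩
    · have h1 := hD' q
      have h2 := hs q
      rw [if_pos rfl, if_neg hpq] at h1
      have := (Point.le_ord_iff (P := q) (m := -(n + d : ℤ)) hg).1 (by omega)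
      simpa only [neg_neg] using this
    · have h1 := hD' p
      have h2 := hs p
      rw [if_pos rfl, if_neg hpq.symm] at h1
      exact (Point.le_ord_iff hg).1 (by omega)
  · rintro ⟨A, B, hg, hgq, hgp⟩
    obtain ⟨D, hD, hD0⟩ := exists_isDivisorOf_add_mul_y hq hg
    -- The residual divisor `div g - n p + (n + d) q` is effective of degree `d`, because `div g`
    -- has degree zero.
    obtain ⟨P, hP⟩ := exists_eq_sum_single (d := d)
      (E := D - Finsupp.single p (n : ℤ) + Finsupp.single q (n + d : ℤ)) (fun Q => by
        rw [Finsupp.add_apply, Finsupp.sub_apply, Finsupp.single_apply, Finsupp.single_apply, hD]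
        by_cases hQq : q = Q
        · subst hQq
          rw [if_neg hpq, if_pos rfl]
          rw [← neg_neg (n + d : ℤ), ← Point.le_ord_iff hg] at hgq
          omega
        rw [if_neg hQq]
        by_cases hQp : p = Q
        · subst hQp
          rw [if_pos rfl]
          rw [← Point.le_ord_iff hg] at hgp
          omega
        · have hx : Q.val C.x ≤ 1 := not_lt.1 fun hx =>
            hQq (Point.IsInfinity.eq_and_val (show Q.IsInfinity from hx) hq).1.symm
          have : (0 : ℤ) ≤ Q.ord (aeval C.x A + aeval C.x B * C.y) := by
            rw [Point.le_ord_iff hg]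
            simpa using Point.val_add_mul_y_le_one hx A B
          rw [if_neg hQp]
          omega)
      (by rw [map_add, map_sub, hD0, degree_single, degree_single]; ring)
    refine ⟨P, _, hg, ?_⟩
    rw [← hP]
    convert hD using 1
    abel

end Divisors

/-! ### The profile expressed through interpolating pairs. -/

section Profile

variable {k : Type*} [Field k] {γ : ℕ} {C : OddHyperellipticCurve k γ} {p q : C.Point}

/-- No cancellation occurs at `q`, so each summand is bounded separately. The guard `B ≠ 0` is
needed because `natDegree 0 = 0` would otherwise impose `2γ + 1 ≤ m`. -/
theorem Point.IsInfinity.val_add_mul_y_le_exp_iff (hq : q.IsInfinity) {A B : k[X]} {m : ℕ} :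
    q.val (aeval C.x A + aeval C.x B * C.y) ≤ WithZero.exp (m : ℤ) ↔
      2 * A.natDegree ≤ m ∧ (B ≠ 0 → 2 * B.natDegree + 2 * γ + 1 ≤ m) := by
  obtain ⟨-, hx, hy⟩ := hq.eq_and_val hq
  rw [hq.val_add_mul_y, max_le_iff]
  refine and_congr ?_ ?_
  · by_cases hA : A = 0
    · simp [hA]
    · rw [hq.val_aeval hA, hx, ← WithZero.exp_nsmul, WithZero.exp_le_exp]
      simp only [nsmul_eq_mul]
      omega
  · by_cases hB : B = 0
    · simp [hB]
    · rw [map_mul, hq.val_aeval hB, hx, hy, ← WithZero.exp_nsmul, ← WithZero.exp_add,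
        WithZero.exp_le_exp]
      simp only [nsmul_eq_mul, hB, ne_eq, not_false_eq_true, true_imp_iff]
      omega

theorem Point.IsInfinity.add_mul_y_ne_zero_iff (hq : q.IsInfinity) {A B : k[X]} :
    aeval C.x A + aeval C.x B * C.y ≠ 0 ↔ A ≠ 0 ∨ B ≠ 0 := by
  rw [← q.val.pos_iff, hq.val_add_mul_y, lt_max_iff, q.val.pos_iff, q.val.pos_iff,
    mul_ne_zero_iff, C.aeval_x_ne_zero, C.aeval_x_ne_zero]
  simp [C.y_ne_zero]

theorem Point.LiesOver.val_aeval_le_exp_iff (hp : p.LiesOver 0)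
    (hx : p.val C.x = WithZero.exp (-1)) {A : k[X]} {n : ℕ} :
    p.val (aeval C.x A) ≤ WithZero.exp (-(n : ℤ)) ↔ X ^ n ∣ A := by
  by_cases hA : A = 0
  · simp [hA]
  obtain ⟨B, hB, hXB⟩ := exists_eq_pow_rootMultiplicity_mul_and_not_dvd A hA 0
  have hB0 : B.eval 0 ≠ 0 := by rwa [dvd_iff_isRoot] at hXB
  have hdvd : X ^ n ∣ A ↔ n ≤ A.rootMultiplicity 0 := by
    rw [le_rootMultiplicity_iff hA, Polynomial.C_0, sub_zero]
  rw [hdvd]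
  conv_lhs => rw [hB]
  rw [map_mul, map_mul, hp.val_aeval_eq_one hB0, mul_one, Polynomial.C_0, sub_zero, map_pow,
    map_pow, aeval_X, hx, ← WithZero.exp_nsmul, WithZero.exp_le_exp]
  simp only [nsmul_eq_mul]
  omega

/-- Modulo order `n`, both `y` and `a` may be replaced by the truncation of `a`, which reduces the
claim to polynomials in `x`. -/
theorem IsExpansionOfY.val_add_mul_y_le_exp_iff {a : PowerSeries k} (ha : IsExpansionOfY p a)
    (hp : p.LiesOver 0) (hx : p.val C.x = WithZero.exp (-1)) {A B : k[X]} {n : ℕ} :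
    p.val (aeval C.x A + aeval C.x B * C.y) ≤ WithZero.exp (-(n : ℤ)) ↔
      (PowerSeries.X : PowerSeries k) ^ n ∣ (A : PowerSeries k) + a * (B : PowerSeries k) := by
  have e1 : aeval C.x A + aeval C.x B * C.y = aeval C.x (A + B * PowerSeries.trunc n a) +
      aeval C.x B * (C.y - aeval C.x (PowerSeries.trunc n a)) := by
    rw [map_add, map_mul]
    ring
  have e2 : p.val (aeval C.x B * (C.y - aeval C.x (PowerSeries.trunc n a))) ≤
      WithZero.exp (-(n : ℤ)) := by
    rw [map_mul]
    exact mul_le_of_le_one_of_le (Point.val_aeval_le_one hp.val_x_le_one B) (ha n)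
  have e3 : (A : PowerSeries k) + a * (B : PowerSeries k) =
      ((A + B * PowerSeries.trunc n a : k[X]) : PowerSeries k) +
        (a - (PowerSeries.trunc n a : PowerSeries k)) * B := by
    push_cast
    ring
  rw [e3, dvd_add_left ((PowerSeries.X_pow_dvd_sub_trunc a n).mul_right _),
    PowerSeries.X_pow_dvd_coe_iff,
    ← hp.val_aeval_le_exp_iff hx]
  constructor
  · intro h
    rw [← add_sub_cancel_right (aeval C.x (A + B * PowerSeries.trunc n a))
      (aeval C.x B * (C.y - aeval C.x (PowerSeries.trunc n a))), ← e1]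
    exact p.val.map_sub_le h e2
  · intro h
    rw [e1]
    exact p.val.map_add_le h e2

theorem profile_le_iff (q : C.Point) (p : C.Point) {n d : ℕ} :
    profile q (pointClass p q) n ≤ d ↔ n • pointClass p q ∈ theta q d := by
  have h := nsmul_mem_thetaZero_profile p q n
  have hsub : ∀ e, thetaZero q e ⊆ theta q e := by
    rintro (_ | e)
    · exact subset_rfl
    · exact Set.sdiff_subset
  refine ⟨fun hle => theta_mono q hle (hsub _ h), fun hd => ?_⟩
  by_contra! hlt
  obtain ⟨e, he⟩ : ∃ e, profile q (pointClass p q) n = e + 1 :=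
    ⟨profile q (pointClass p q) n - 1, by omega⟩
  rw [he] at h hlt
  exact h.2 (theta_mono q (by omega) hd)

/-- The multiplication profile in terms of the power series expansion. -/
theorem PointData.profile_le_iff [IsAlgClosed k] [CharZero k] (S : C.PointData) {n d : ℕ} :
    profile S.q (pointClass S.p S.q) n ≤ d ↔ HasInterpolant γ S.a n d := by
  have hb : S.b ≠ 0 := by
    intro h
    apply S.f_zero_ne_zero
    rw [← S.b_sq, h, zero_pow two_ne_zero]
  have hp : S.p.LiesOver 0 := S.isAffine_p.1
  have hx : S.p.val C.x = WithZero.exp (-1) := by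
    simpa using (S.isAffine_p.eq_and_val_of_ne_zero hb S.isAffine_p).2
  have hpq : S.p ≠ S.q := fun h => S.isInfinity_q.not_isAffine (h ▸ S.isAffine_p)
  rw [OddHyperellipticCurve.profile_le_iff, nsmul_mem_theta_iff_exists_function S.isInfinity_q hpq]
  simp only [S.isInfinity_q.add_mul_y_ne_zero_iff,
    S.isExpansion_a.val_add_mul_y_le_exp_iff hp hx, ← Nat.cast_add,
    S.isInfinity_q.val_add_mul_y_le_exp_iff, and_assoc]
  rfl

end Profile

end OddHyperellipticCurve

theorem lemma4p10 {k : Type*} [Field k] [IsAlgClosed k] [CharZero k] (γ : ℕ) (hγ : 2 ≤ γ) :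
    (∀ (C : OddHyperellipticCurve k γ) (S : C.PointData) (n : ℕ), γ + 2 ≤ n →
      (OddHyperellipticCurve.profile S.q (OddHyperellipticCurve.pointClass S.p S.q) n < γ ↔
        hankelDet γ S.a n = 0)) ∧
    (∀ (C C' : OddHyperellipticCurve k γ) (S : C.PointData) (S' : C'.PointData),
      (∀ n : ℕ, γ + 2 ≤ n → (hankelDet γ S.a n = 0 ↔ hankelDet γ S'.a n = 0)) →
      ∀ j : ℕ, 1 ≤ j →
        OddHyperellipticCurve.profile S.q (OddHyperellipticCurve.pointClass S.p S.q) j =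
          OddHyperellipticCurve.profile S'.q (OddHyperellipticCurve.pointClass S'.p S'.q) j) := by
  constructor
  · intro C S n hn
    rw [← hasInterpolant_iff_hankelDet (d := γ - 1) (by omega) hn, ← S.profile_le_iff]
    omega
  · intro C C' S S' h j _
    -- Two natural numbers with the same upper bounds are equal.
    have key : ∀ d, OddHyperellipticCurve.profile S.q
        (OddHyperellipticCurve.pointClass S.p S.q) j ≤ d ↔
        OddHyperellipticCurve.profile S'.q (OddHyperellipticCurve.pointClass S'.p S'.q) j ≤ d :=
      fun d => by
        rw [S.profile_le_iff, S'.profile_le_iff]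
        exact hasInterpolant_congr (by omega) h j d
    exact le_antisymm ((key _).2 le_rfl) ((key _).1 le_rfl)
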